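/- Let $B^2$ be the open unit disk of $\mathbb R^2$, $\rho(x)=1-|x|^2$, and $\alpha>-1$. For measurable $u\colon B^2\to\mathbb C$ let $\|u\|_{L^2_{\rho^\alpha}}=\big(\int_{B^2}|u|^2\rho^\alpha\big)^{1/2}$ and, with weak derivatives, $$|u|_{H^k_{\rho^\alpha}}=\Big(\sum_{a+b=k}\|\partial_1^a\partial_2^b u\|_{L^2_{\rho^\alpha}}^2\Big)^{1/2},\qquad \|u\|_{H^m_{\rho^\alpha}}=\Big(\sum_{k=0}^m|u|_{H^k_{\rho^\alpha}}^2\Big)^{1/2};$$ $H^m_{\rho^\alpha}$ is the space of $u\in L^2_{\rho^\alpha}$ for which the latter norm is finite. For $N\in\mathbb N_0$ let $\mathrm{Proj}_N$ be the $L^2_{\rho^\alpha}$-orthogonal projection onto the complex bivariate polynomials of total degree at most $N$. For $n\in\mathbb N_0$ let $$P^{(\alpha)}_{n,n}(x)=\frac{\Gamma(n+1)\,\Gamma(\alpha+1)}{\Gamma(n+\alpha+1)}\,P_n^{(\alpha,0)}(2|x|^2-1),$$ where $P_n^{(\alpha,0)}$ is the Jacobi polynomial. With $(a)_n=\prod_{i=0}^{n-1}(a+i)$,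 let, for integers $j\ge l\ge1$, $$t_j^{(\alpha,l)}=\sum_{k=0}^{l}\frac{(-l)_k\,\Gamma(\alpha+j+l-k+1)^2\,(\alpha+2j+2l-2k+1)}{\Gamma(k+1)\,\Gamma(j+l-k+1)^2\,(\alpha+2j+l-k+1)_{l+1}}\,P^{(\alpha)}_{j+l-k,\,j+l-k},$$ $$N_j^{(l)}=2j+2l-1,\qquad R_j^{(\alpha,l)}=t_j^{(\alpha,l)}-\mathrm{Proj}_{N_j^{(l)}}\big(t_j^{(\alpha,l)}\big).$$ **Theorem 3.13.** Let $\alpha>-1$. 1. The power of $N+1$ in the estimate $\|u-\mathrm{Proj}_N u\|_{L^2_{\rho^\alpha}}\le C(N+1)^{-k}\|u\|_{H^k_{\rho^\alpha}}$ is sharp: if $k\in\mathbb N_0$, $e\in\mathbb R$ and there is a constant $C$ such that $\|u-\mathrm{Proj}_N u\|_{L^2_{\rho^\alpha}}\le C(N+1)^{e}\|u\|_{H^k_{\rho^\alpha}}$ for all $u\in H^k_{\rho^\alpha}$ and $N\in\mathbb N_0$, then $e\ge -k$. 2. The power of $N$ in the estimate $\|u-\mathrm{Proj}_N u\|_{H^1_{\rho^\alpha}}\le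 CN^{3/2-l}\|u\|_{H^l_{\rho^\alpha}}$ is sharp: if $l\in\mathbb N$ with $l\ge1$, $e\in\mathbb R$ and there is a constant $C$ such that $\|u-\mathrm{Proj}_N u\|_{H^1_{\rho^\alpha}}\le CN^{e}\|u\|_{H^l_{\rho^\alpha}}$ for all $u\in H^l_{\rho^\alpha}$ and all integers $N\ge1$, then $e\ge 3/2-l$. 3. For every integer $l\ge1$ and $r\in\{0,1\}$ there are constants $C,\tilde C>0$ such that, as $j\to\infty$, $$\frac{|R_j^{(\alpha,l)}|_{H^r_{\rho^\alpha}}}{|t_j^{(\alpha,l)}|_{H^l_{\rho^\alpha}}}\sim C\,j^{\frac32r-l}\sim\tilde C\,\big(N_j^{(l)}\big)^{\frac32r-l},$$ where $\sim$ means that the ratio of both sides tends to $1$; and the same holds, with some constants $C,\tilde C>0$, if both seminorms are replaced by the norms of $H^r_{\rho^\alpha}$ and $H^l_{\rho^\alpha}$. -/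

import Mathlib

open MeasureTheory Filter Asymptotics
open scoped ContDiff ENNReal

noncomputable section

namespace Zernike

/-! The plane is identified with `ℂ` (`x₁ = re z`, `x₂ = im z`), which carries the Euclidean norm
and the Lebesgue measure of the plane. Functions on the unit disk are functions `ℂ → ℂ` whose
values outside of the disk play no role. -/

/-- The open unit disk. -/
def disk : Set ℂ := Metric.ball 0 1

/-- The measure `ρ ^ α dx` on the unit disk, where `ρ(x) = 1 - |x|²`. -/
def wMeasure (α : ℝ) : Measure ℂ :=
  (volume.restrict disk).withDensity fun z => ENNReal.ofReal ((1 - ‖z‖ ^ 2) ^ α)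

/-- The weighted `L²` norm over the disk. -/
def l2Norm (α : ℝ) (u : ℂ → ℂ) : ℝ := (eLpNorm u 2 (wMeasure α)).toReal

/-- The weighted `L²` inner product over the disk. -/
def wInner (α : ℝ) (u v : ℂ → ℂ) : ℂ := ∫ z, u z * (starRingEnd ℂ) (v z) ∂(wMeasure α)

/-! ### Weak derivatives and weighted Sobolev spaces -/

/-- Classical derivative in the direction `v`; `v = 1` gives `∂₁` and `v = I` gives `∂₂`. -/
def dirDeriv (v : ℂ) (φ : ℂ → ℂ) : ℂ → ℂ := fun z => fderiv ℝ φ z v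

/-- The classical partial derivative `∂₁ ^ a ∂₂ ^ b φ`. -/
def partialDeriv (a b : ℕ) (φ : ℂ → ℂ) : ℂ → ℂ :=
  (dirDeriv 1)^[a] ((dirDeriv Complex.I)^[b] φ)

/-- `g` is the weak partial derivative `∂₁ ^ a ∂₂ ^ b u` in the unit disk. -/
def HasWeakDeriv (a b : ℕ) (u g : ℂ → ℂ) : Prop :=
  LocallyIntegrableOn u disk ∧ LocallyIntegrableOn g disk ∧
    ∀ φ : ℂ → ℂ, ContDiff ℝ ∞ φ → HasCompactSupport φ → tsupport φ ⊆ disk →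
      ∫ z in disk, u z * partialDeriv a b φ z = (-1) ^ (a + b) * ∫ z in disk, g z * φ z

/-- The weighted `L²` norm of the weak partial derivative `∂₁ ^ a ∂₂ ^ b u`. Weak derivatives are
unique almost everywhere, so that the infimum is over equal values; it is `∞` if `u` does not have
this weak derivative. -/
def eDerivNorm (α : ℝ) (a b : ℕ) (u : ℂ → ℂ) : ℝ≥0∞ :=
  ⨅ (g : ℂ → ℂ) (_ : HasWeakDeriv a b u g), eLpNorm g 2 (wMeasure α)

/-- The weighted Sobolev seminorm of order `k`, with values in `[0, ∞]`. -/
def eSeminorm (α : ℝ) (k : ℕ) (u : ℂ → ℂ) : ℝ≥0∞ :=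
  (∑ p ∈ Finset.HasAntidiagonal.antidiagonal k, eDerivNorm α p.1 p.2 u ^ 2) ^ (1 / 2 : ℝ)

/-- The weighted Sobolev norm of order `m`, with values in `[0, ∞]`. -/
def eSobolevNorm (α : ℝ) (m : ℕ) (u : ℂ → ℂ) : ℝ≥0∞ :=
  (∑ k ∈ Finset.range (m + 1), eSeminorm α k u ^ 2) ^ (1 / 2 : ℝ)

/-- Membership in the weighted Sobolev space `H^m` over the disk with weight `ρ ^ α`. -/
def MemSobolev (α : ℝ) (m : ℕ) (u : ℂ → ℂ) : Prop :=
  MemLp u 2 (wMeasure α) ∧ eSobolevNorm α m u < ⊤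

/-- The weighted Sobolev seminorm of order `k`. -/
def seminorm (α : ℝ) (k : ℕ) (u : ℂ → ℂ) : ℝ := (eSeminorm α k u).toReal

/-- The weighted Sobolev norm of order `m`. -/
def sobolevNorm (α : ℝ) (m : ℕ) (u : ℂ → ℂ) : ℝ := (eSobolevNorm α m u).toReal

/-! ### Orthogonal projection onto polynomials -/

/-- The function on the plane given by a complex polynomial in the coordinates `x₁`, `x₂`. -/
def polyFun : MvPolynomial (Fin 2) ℂ →ₗ[ℂ] (ℂ → ℂ) where
  toFun p := fun z => MvPolynomial.eval ![(z.re : ℂ), (z.im : ℂ)] p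
  map_add' p q := by ext z; simp
  map_smul' c p := by ext z; simp

/-- Bivariate complex polynomials of total degree at most `N`, as functions on the plane. -/
def polySpace (N : ℕ) : Submodule ℂ (ℂ → ℂ) :=
  (MvPolynomial.restrictTotalDegree (Fin 2) ℂ N).map polyFun

open Classical in
/-- The orthogonal projection of `u` onto `polySpace N` with respect to the weighted `L²` inner
product: the polynomial `p` of degree at most `N` such that `u - p` is orthogonal to every
polynomial of degree at most `N`. For `-1 < α` and `u` in the weighted `L²` space there is exactly
one such `p`. -/
def proj (α : ℝ) (N : ℕ) (u : ℂ → ℂ) : ℂ → ℂ :=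
  if h : ∃ p ∈ polySpace N, ∀ q ∈ polySpace N, wInner α (u - p) q = 0 then h.choose else 0

/-! ### Jacobi and Zernike polynomials -/

/-- The Pochhammer symbol `a (a + 1) ⋯ (a + n - 1)`. -/
def poch (a : ℝ) (n : ℕ) : ℝ := ∏ i ∈ Finset.range n, (a + i)

/-- The Jacobi polynomial of degree `n` and parameter `(α, β)`,
`(α + 1)ₙ / n! * ₂F₁(-n, n + α + β + 1; α + 1; (1 - x) / 2)`. -/
def jacobi (α β : ℝ) (n : ℕ) (x : ℝ) : ℝ :=
  poch (α + 1) n / n.factorial *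
    ∑ k ∈ Finset.range (n + 1),
      poch (-n) k * poch (n + α + β + 1) k / (poch (α + 1) k * k.factorial) * ((1 - x) / 2) ^ k

/-- The Zernike polynomial
`Γ(μ+1) Γ(α+1) / Γ(μ+α+1) * r ^ |m-n| * exp(i (m-n) θ) * P_μ^(α, |m-n|)(2 r² - 1)`
in polar coordinates, where `μ = min(m, n)`. -/
def zernike (α : ℝ) (m n : ℕ) (z : ℂ) : ℂ :=
  ((Real.Gamma ((min m n : ℕ) + 1) * Real.Gamma (α + 1) /
      Real.Gamma ((min m n : ℕ) + α + 1) : ℝ) : ℂ) *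
    (‖z‖ : ℂ) ^ ((m : ℤ) - n).natAbs *
    Complex.exp (Complex.I * (((m : ℤ) - n : ℤ) : ℂ) * (Complex.arg z : ℂ)) *
    (jacobi α (((m : ℤ) - n).natAbs : ℝ) (min m n) (2 * ‖z‖ ^ 2 - 1) : ℂ)

/-- The coefficient of the Zernike polynomial with indices `(j+l-k, j+l-k)` in `tPoly α l j`. -/
def tCoeff (α : ℝ) (l j k : ℕ) : ℝ :=
  poch (-l) k * Real.Gamma (α + j + l - k + 1) ^ 2 * (α + 2 * j + 2 * l - 2 * k + 1) /
    (Real.Gamma ((k : ℝ) + 1) * Real.Gamma ((j : ℝ) + l - k + 1) ^ 2 *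
      poch (α + 2 * j + l - k + 1) (l + 1))

/-- The polynomial `t_j^(α,l)`. -/
def tPoly (α : ℝ) (l j : ℕ) (z : ℂ) : ℂ :=
  ∑ k ∈ Finset.range (l + 1), (tCoeff α l j k : ℂ) * zernike α (j + l - k) (j + l - k) z

/-- The truncation degree `N_j^(l) = 2 j + 2 l - 1` (used for `l ≥ 1`). -/
def truncDeg (l j : ℕ) : ℕ := 2 * j + 2 * l - 1

/-- The residual of the projection of `t_j^(α,l)` onto polynomials of degree at most `N_j^(l)`. -/
def residual (α : ℝ) (l j : ℕ) : ℂ → ℂ := tPoly α l j - proj α (truncDeg l j) (tPoly α l j)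

end Zernike

end

noncomputable section

namespace Zernike

open Polynomial
open scoped Topology

/-! All three claims rest on one explicit family. In the variable x = 1 - |z|², and with n = j + l,
the polynomial t_j is a positive multiple of the Jacobi polynomial J of degree n with parameters (α
- l, 0) (`tPoly_eq`). Each derivative raises the first parameter by one, so the derivatives of order
l have first parameter α, the exponent of the weight, and their norms are known exactly. More
precisely, ∂^p ∂bar^q J is a power of z or of its conjugate, times a Jacobi polynomial, times a
factor of size n^(p+q) (`dirDeriv_wirt`). For fixed p + q these have distinct angular frequencies
and are orthogonal. The squared seminorm of order l of J is therefore asymptotic to a constant times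
n^(2l-1) (`tendsto_jacSemiSq_top`), and the seminorms of lower order are negligible
(`tendsto_jacSemiSq_low`).

On the other hand, l applications of a contiguous relation expand J in Jacobi polynomials with
parameters (α, 0) and degrees n, ..., n - l (`jac_connection`). The term of degree n is orthogonal
to all polynomials of total degree below 2n, and the others have total degree at most 2n - 2. As N =
2n - 1, the residual is exactly the first term (`residual_ae_eq`), and its coefficient tends to
2^(-l), up to the common factor of t_j. Its squared L² norm behaves like 1/n. Its gradient has first
parameter α + 1 but is measured with the weight x^α; the exact value of this mismatched integral
(`wInt_jac_deriv_sq`) makes the squared H¹ seminorm behave like n², one power of n more than in the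
matched case. This is the origin of the 3/2.

The squared quotients thus behave like n^(3r-2l). Inserting t_j into the estimates gives the lower
bounds for the exponents.

The parameter α - l may be a negative integer. Hence Jacobi polynomials are given by coefficients
without division by parameters, identities between them are checked coefficientwise for all real
parameters, and integration in x is a linear functional on polynomials, `wInt`. -/

/-! ### Pochhammer symbols -/

theorem poch_zero (a : ℝ) : poch a 0 = 1 := by simp [poch]

theorem poch_succ (a : ℝ) (n : ℕ) : poch a (n + 1) = poch a n * (a + n) := by
  simp [poch, Finset.prod_range_succ]

theorem poch_succ_left (a : ℝ) (n : ℕ) : poch a (n + 1) = a * poch (a + 1) n := by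
  simp only [poch, Finset.prod_range_succ']
  rw [mul_comm]
  congr 1
  · simp
  · exact Finset.prod_congr rfl fun i _ => by push_cast; ring

theorem poch_add (a : ℝ) (m n : ℕ) : poch a (m + n) = poch a m * poch (a + m) n := by
  simp only [poch, Finset.prod_range_add]
  congr 1
  exact Finset.prod_congr rfl fun i _ => by push_cast; ring

theorem poch_pos {a : ℝ} (ha : 0 < a) (n : ℕ) : 0 < poch a n :=
  Finset.prod_pos fun i _ => by positivity

/-! ### Coefficient identities for Jacobi polynomials with arbitrary real parameters -/

/-- The coefficients of the Jacobi polynomial of degree `m` in powers of `(1 - x) / 2`. -/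
def jacCoeff (m : ℕ) (a d : ℝ) (k : ℕ) : ℝ :=
  (-1) ^ k * (m.choose k : ℝ) * poch (m + a + d + 1) k * poch (a + k + 1) (m - k) / m.factorial

theorem jacCoeff_eq_zero {m k : ℕ} (h : m < k) (a d : ℝ) : jacCoeff m a d k = 0 := by
  simp [jacCoeff, Nat.choose_eq_zero_of_lt h]

theorem choose_rel (m k : ℕ) (h : k ≤ m) :
    ((m.choose (k + 1) : ℕ) : ℝ) * (k + 1) = m.choose k * (m - k) := by
  have := Nat.choose_succ_right_eq m k
  have h2 : ((m.choose (k + 1) * (k + 1) : ℕ) : ℝ) = ((m.choose k * (m - k) : ℕ) : ℝ) := by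
    rw [this]
  push_cast [Nat.cast_sub h] at h2
  exact h2

theorem choose_succ_cast (m k : ℕ) :
    (((m + 1).choose (k + 1) : ℕ) : ℝ) = m.choose k + m.choose (k + 1) := by
  rw [Nat.choose_succ_succ]; push_cast; rfl

theorem jacCoeff_deriv (m : ℕ) (a d : ℝ) (k : ℕ) :
    jacCoeff (m + 1) a d (k + 1) * (k + 1) = -(m + a + d + 2) * jacCoeff m (a + 1) (d + 1) k := by
  have h : (((m + 1).choose (k + 1) : ℕ) : ℝ) * (k + 1) = (m + 1) * m.choose k := by
    have := Nat.add_one_mul_choose_eq m k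
    exact_mod_cast this.symm
  have hf : (((m + 1).factorial : ℕ) : ℝ) = (m + 1) * m.factorial := by
    rw [Nat.factorial_succ]; push_cast; ring
  have e1 : poch (((m + 1 : ℕ) : ℝ) + a + d + 1) (k + 1)
      = (m + a + d + 2) * poch ((m : ℝ) + (a + 1) + (d + 1) + 1) k := by
    rw [poch_succ_left]
    congr 1
    · push_cast; ring
    · congr 1; push_cast; ring
  have e2 : poch (a + ((k + 1 : ℕ) : ℝ) + 1) (m + 1 - (k + 1)) = poch (a + 1 + k + 1) (m - k) := by
    rw [Nat.add_sub_add_right]; congr 1; push_cast; ring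
  have hm : (m : ℝ) + 1 ≠ 0 := by positivity
  have hm' : (m.factorial : ℝ) ≠ 0 := by positivity
  simp only [jacCoeff, e1, e2, hf, pow_succ]
  field_simp
  linear_combination (-(m + a + d + 2) * poch ((m : ℝ) + (a + 1) + (d + 1) + 1) k *
    poch (a + 1 + k + 1) (m - k)) * h

theorem jacCoeff_adjoint_zero (m : ℕ) (a d : ℝ) :
    (a + 1) * jacCoeff m (a + 1) (d + 1) 0 = (m + 1) * jacCoeff (m + 1) a d 0 := by
  have hf : (((m + 1).factorial : ℕ) : ℝ) = (m + 1) * m.factorial := by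
    rw [Nat.factorial_succ]; push_cast; ring
  simp only [jacCoeff, hf, poch_zero, Nat.sub_zero, poch_succ_left]
  have hm : (m : ℝ) + 1 ≠ 0 := by positivity
  have hm' : (m.factorial : ℝ) ≠ 0 := by positivity
  simp
  field_simp

theorem jacCoeff_adjoint_succ (m : ℕ) (a d : ℝ) (k : ℕ) :
    (a + 1 + (k + 1)) * jacCoeff m (a + 1) (d + 1) (k + 1)
      - (a + d + 1 + (k + 1)) * jacCoeff m (a + 1) (d + 1) k
      = (m + 1) * jacCoeff (m + 1) a d (k + 1) := by
  rcases lt_or_ge m k with hk | hk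
  · rw [jacCoeff_eq_zero (by omega), jacCoeff_eq_zero (by omega), jacCoeff_eq_zero (by omega)]
    ring
  have hf : (((m + 1).factorial : ℕ) : ℝ) = (m + 1) * m.factorial := by
    rw [Nat.factorial_succ]; push_cast; ring
  have hm : (m : ℝ) + 1 ≠ 0 := by positivity
  have hm' : (m.factorial : ℝ) ≠ 0 := by positivity
  have hc := choose_rel m k hk
  have e1 : poch (((m + 1 : ℕ) : ℝ) + a + d + 1) (k + 1)
      = (m + a + d + 2) * poch ((m : ℝ) + (a + 1) + (d + 1) + 1) k := by
    rw [poch_succ_left]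
    congr 1
    · push_cast; ring
    · congr 1; push_cast; ring
  -- The binomial coefficient stays in the identity for the case k = m: the truncated `m - (k + 1)`
  -- is then wrong, but the coefficient vanishes.
  have e3 : (a + 1 + (k + 1)) * ((m.choose (k + 1) : ℝ) * poch (a + 1 + ((k + 1 : ℕ) : ℝ) + 1)
      (m - (k + 1))) = m.choose (k + 1) * poch (a + 1 + k + 1) (m - k) := by
    rcases Nat.lt_or_eq_of_le hk with h | h
    · obtain ⟨r, rfl⟩ := Nat.exists_eq_add_of_lt h
      have : k + r + 1 - k = r + 1 := by omega
      rw [this, poch_succ_left]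
      have : k + r + 1 - (k + 1) = r := by omega
      rw [this]
      have : a + 1 + ((k + 1 : ℕ) : ℝ) + 1 = a + 1 + k + 1 + 1 := by push_cast; ring
      rw [this]; ring
    · subst h; simp
  have e2 : poch (a + ((k + 1 : ℕ) : ℝ) + 1) (m + 1 - (k + 1)) = poch (a + 1 + k + 1) (m - k) := by
    rw [Nat.add_sub_add_right]; congr 1; push_cast; ring
  simp only [jacCoeff, e1, e2, hf, pow_succ, poch_succ, choose_succ_cast]
  field_simp
  set P := poch ((m : ℝ) + (a + 1) + (d + 1) + 1) k
  set Q := poch (a + 1 + k + 1) (m - k)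
  linear_combination (-(P * (↑m + (a + 1) + (d + 1) + 1 + ↑k))) * e3 - P * Q * hc

theorem jacCoeff_lower (m : ℕ) (a d : ℝ) (k : ℕ) :
    (d + k) * jacCoeff m a d k - (k + 1) * jacCoeff m a d (k + 1)
      = (m + d) * jacCoeff m (a + 1) (d - 1) k := by
  rcases lt_or_ge m k with hk | hk
  · rw [jacCoeff_eq_zero (by omega), jacCoeff_eq_zero (by omega), jacCoeff_eq_zero (by omega)]
    ring
  have hm' : (m.factorial : ℝ) ≠ 0 := by positivity
  have hc := choose_rel m k hk
  have e1 : (m : ℝ) + (a + 1) + (d - 1) + 1 = m + a + d + 1 := by ring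
  rcases Nat.lt_or_eq_of_le hk with h | h
  · obtain ⟨r, rfl⟩ := Nat.exists_eq_add_of_lt h
    have r1 : k + r + 1 - k = r + 1 := by omega
    have r2 : k + r + 1 - (k + 1) = r := by omega
    have r3 : a + 1 + (k : ℝ) + 1 = a + k + 1 + 1 := by ring
    have r4 : a + ((k + 1 : ℕ) : ℝ) + 1 = a + k + 1 + 1 := by push_cast; ring
    simp only [jacCoeff, e1, r1, r2, r3, r4, pow_succ]
    rw [poch_succ_left (a + k + 1) r, poch_succ (a + k + 1 + 1) r,
      poch_succ _ k]
    field_simp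
    push_cast at hc ⊢
    set P := poch ((k : ℝ) + r + 1 + a + d + 1) k
    set Q := poch (a + k + 1 + 1) r
    linear_combination P * Q * (k + r + 1 + a + d + 1 + k) * hc
  · subst h
    rw [jacCoeff_eq_zero (Nat.lt_succ_self k)]
    simp only [jacCoeff, e1, Nat.sub_self, poch_zero]
    ring

theorem jacCoeff_contiguous (m : ℕ) (a d : ℝ) (k : ℕ) :
    (2 * m + 2 + a + d) * jacCoeff (m + 1) (a - 1) d k
      = (m + 1 + a + d) * jacCoeff (m + 1) a d k - (m + 1 + d) * jacCoeff m a d k := by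
  have hf : (((m + 1).factorial : ℕ) : ℝ) = (m + 1) * m.factorial := by
    rw [Nat.factorial_succ]; push_cast; ring
  have hm : (m : ℝ) + 1 ≠ 0 := by positivity
  have hm' : (m.factorial : ℝ) ≠ 0 := by positivity
  have hch : k ≤ m + 1 → ((m.choose k : ℕ) : ℝ) * (m + 1) = (m + 1).choose k * (m + 1 - k) := by
    intro h
    have := Nat.choose_mul_succ_eq m k
    have h2 : ((m.choose k * (m + 1) : ℕ) : ℝ) = (((m + 1).choose k * (m + 1 - k) : ℕ) : ℝ) := by
      exact_mod_cast this
    push_cast [Nat.cast_sub h] at h2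
    exact h2
  rcases lt_or_ge (m + 1) k with hk | hk
  · rw [jacCoeff_eq_zero (by omega), jacCoeff_eq_zero (by omega), jacCoeff_eq_zero (by omega)]
    ring
  have hc := hch hk
  have key : ∀ b : ℝ, (b + k) * poch b k = b * poch (b + 1) k := fun b => by
    rw [← poch_succ_left, poch_succ]; ring
  have e0 := key (m + 1 + a + d)
  have s1 : ((m + 1 : ℕ) : ℝ) + (a - 1) + d + 1 = m + 1 + a + d := by push_cast; ring
  have s2 : ((m + 1 : ℕ) : ℝ) + a + d + 1 = m + 1 + a + d + 1 := by push_cast; ring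
  have s3 : (m : ℝ) + a + d + 1 = m + 1 + a + d := by ring
  have s4 : a - 1 + (k : ℝ) + 1 = a + k := by ring
  simp only [jacCoeff, s1, s2, s3, s4, hf]
  rcases Nat.lt_or_eq_of_le hk with h | h
  · obtain ⟨r, rfl⟩ := Nat.exists_eq_add_of_le (Nat.lt_succ_iff.mp h)
    have r1 : k + r + 1 - k = r + 1 := by omega
    have r2 : k + r - k = r := by omega
    rw [r1, r2, poch_succ_left (a + k) r, poch_succ (a + k + 1) r]
    field_simp
    push_cast at hc ⊢
    push_cast at e0
    set Q := poch (a + k + 1) r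
    set P := poch ((k : ℝ) + r + 1 + a + d) k
    set P' := poch ((k : ℝ) + r + 1 + a + d + 1) k
    linear_combination Q * (((k + r + 1).choose k : ℝ) * (a + k + 1 + r) * e0)
      + Q * P * (k + r + 1 + d) * hc
  · subst h
    simp [poch_zero]
    push_cast at e0
    field_simp
    linear_combination e0

/-! ### Polynomial identities: derivative, adjoint, lowering and contiguous relations -/

/-- The Jacobi polynomial of degree `m` with parameters `(a, d)` at `1 - 2 X`. -/
def jac (m : ℕ) (a d : ℝ) : ℝ[X] := ∑ k ∈ Finset.range (m + 1), monomial k (jacCoeff m a d k)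

theorem coeff_jac (m : ℕ) (a d : ℝ) (k : ℕ) : (jac m a d).coeff k = jacCoeff m a d k := by
  simp only [jac, finsetSum_coeff, coeff_monomial]
  rw [Finset.sum_ite_eq']
  split_ifs with h
  · rfl
  · rw [jacCoeff_eq_zero (by simpa using h)]

theorem natDegree_jac_le (m : ℕ) (a d : ℝ) : (jac m a d).natDegree ≤ m :=
  natDegree_le_iff_coeff_eq_zero.2 fun k hk => by rw [coeff_jac, jacCoeff_eq_zero hk]

theorem jac_zero (a d : ℝ) : jac 0 a d = 1 := by
  simp [jac, jacCoeff, poch_zero]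

theorem derivative_jac (m : ℕ) (a d : ℝ) :
    derivative (jac (m + 1) a d) = C (-(m + a + d + 2)) * jac m (a + 1) (d + 1) := by
  ext k
  rw [coeff_derivative, coeff_C_mul, coeff_jac, coeff_jac, jacCoeff_deriv]

/-- This is the Rodrigues-type relation (x^(a+1) (1-x)^(d+1) P)' = (m+1) x^a (1-x)^d Q with the
common factor x^a (1-x)^d removed, where P is the polynomial with raised parameters and Q the one of
degree m + 1. It makes integration by parts against Jacobi weights possible. -/
theorem jac_adjoint (m : ℕ) (a d : ℝ) :
    (C (a + 1) * (1 - X) - C (d + 1) * X) * jac m (a + 1) (d + 1)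
      + X * (1 - X) * derivative (jac m (a + 1) (d + 1)) = C ((m : ℝ) + 1) * jac (m + 1) a d := by
  have e : (C (a + 1) * (1 - X) - C (d + 1) * X) * jac m (a + 1) (d + 1)
      + X * (1 - X) * derivative (jac m (a + 1) (d + 1))
      = C (a + 1) * jac m (a + 1) (d + 1) + X * (derivative (jac m (a + 1) (d + 1))
        - C (a + d + 2) * jac m (a + 1) (d + 1) - X * derivative (jac m (a + 1) (d + 1))) := by
    have : (C (a + d + 2) : ℝ[X]) = C (a + 1) + C (d + 1) := by rw [← C_add]; congr 1; ring
    rw [this]; ring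
  rw [e]
  ext k
  cases k with
  | zero => simp [coeff_jac, ← jacCoeff_adjoint_zero]
  | succ k =>
    rw [coeff_C_mul, coeff_jac, ← jacCoeff_adjoint_succ, coeff_add, coeff_X_mul, coeff_sub,
      coeff_sub, coeff_C_mul, coeff_C_mul, coeff_jac, coeff_jac, coeff_derivative, coeff_jac]
    cases k with
    | zero => simp; ring
    | succ k => rw [coeff_X_mul, coeff_derivative, coeff_jac]; push_cast; ring

/-- Up to a factor, the left side is the derivative of (1-x)^d P. With 1 - x = |z|² it is what ∂
produces from z^d P(1 - |z|²), after a factor z^(d-1) is taken out. -/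
theorem jac_lower (m : ℕ) (a d : ℝ) :
    C d * jac m a d - (1 - X) * derivative (jac m a d) = C (m + d) * jac m (a + 1) (d - 1) := by
  ext k
  rw [coeff_C_mul, coeff_jac, ← jacCoeff_lower, sub_mul, one_mul, coeff_sub, coeff_sub,
    coeff_C_mul, coeff_derivative, coeff_jac, coeff_jac]
  cases k with
  | zero => simp
  | succ k => rw [coeff_X_mul, coeff_derivative, coeff_jac]; push_cast; ring

/-- Lowers the first parameter by one at the price of one lower degree. Iterated, it gives both the
connection formula and the decay of norms whose parameter is below the weight exponent. -/
theorem jac_contiguous (m : ℕ) (a d : ℝ) :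
    C (2 * m + 2 + a + d) * jac (m + 1) (a - 1) d
      = C (m + 1 + a + d) * jac (m + 1) a d - C (m + 1 + d) * jac m a d := by
  ext k
  rw [coeff_sub, coeff_C_mul, coeff_C_mul, coeff_C_mul, coeff_jac, coeff_jac, coeff_jac,
    jacCoeff_contiguous]

theorem eval_one_jac_succ (m : ℕ) (a d : ℝ) :
    ((m : ℝ) + 1) * (jac (m + 1) a d).eval 1 = -(d + 1) * (jac m (a + 1) (d + 1)).eval 1 := by
  have := congrArg (eval 1) (jac_adjoint m a d)
  simp at this
  linarith

/-- Squaring avoids the sign (-1)^m of the value itself. -/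
theorem eval_one_jac_sq (m : ℕ) (a d : ℝ) :
    (jac m a d).eval 1 ^ 2 = (poch (d + 1) m / m.factorial) ^ 2 := by
  induction m generalizing a d with
  | zero => simp [jac_zero, poch_zero]
  | succ m ih =>
    have h := eval_one_jac_succ m a d
    have hm : (m : ℝ) + 1 ≠ 0 := by positivity
    have hm' : (m.factorial : ℝ) ≠ 0 := by positivity
    have h2 := ih (a + 1) (d + 1)
    have : (jac (m + 1) a d).eval 1 = -(d + 1) * (jac m (a + 1) (d + 1)).eval 1 / (m + 1) := by
      field_simp; linarith
    rw [this, div_pow, mul_pow, h2, poch_succ_left, Nat.factorial_succ]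
    push_cast
    field_simp

/-! ### Weighted integration of polynomials: orthogonality and norms -/

/-- The linear functional `q ↦ ∫ x in 0..1, x ^ a * q x` on polynomials, for `-1 < a`. -/
def wInt (a : ℝ) : ℝ[X] →ₗ[ℝ] ℝ := Polynomial.lsum fun k => (1 / (a + k + 1)) • LinearMap.id

theorem wInt_monomial (a : ℝ) (k : ℕ) (c : ℝ) : wInt a (monomial k c) = c / (a + k + 1) := by
  simp [wInt, Polynomial.lsum_apply, sum_monomial_index]
  ring

theorem wInt_C_mul (a c : ℝ) (q : ℝ[X]) : wInt a (C c * q) = c * wInt a q := by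
  rw [← smul_eq_C_mul, map_smul, smul_eq_mul]

theorem wInt_X_mul (a : ℝ) (q : ℝ[X]) : wInt a (X * q) = wInt (a + 1) q := by
  induction q using Polynomial.induction_on' with
  | add p q hp hq => rw [mul_add, map_add, map_add, hp, hq]
  | monomial k c =>
    rw [X_mul_monomial, wInt_monomial, wInt_monomial]
    push_cast; congr 1; ring

/-- The integrand is the derivative of x^(a+1) q, whose boundary value at 0 vanishes because a > -1.
-/
theorem wInt_by_parts {a : ℝ} (ha : -1 < a) (q : ℝ[X]) :
    (a + 1) * wInt a q + wInt a (X * derivative q) = q.eval 1 := by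
  induction q using Polynomial.induction_on' with
  | add p q hp hq =>
    rw [derivative_add, mul_add, map_add, map_add, eval_add, ← hp, ← hq]; ring
  | monomial k c =>
    rw [wInt_monomial, derivative_monomial]
    cases k with
    | zero =>
      simp
      field_simp [show a + 1 ≠ 0 by linarith]
    | succ k =>
      rw [X_mul_monomial, Nat.add_sub_cancel, wInt_monomial]
      have : a + ((k + 1 : ℕ) : ℝ) + 1 ≠ 0 := by
        have : (0:ℝ) ≤ k := by positivity
        push_cast; linarith
      simp
      push_cast at this ⊢
      field_simp
      ring

theorem wInt_one_sub_pow {a : ℝ} (ha : -1 < a) (d : ℕ) :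
    wInt a ((1 - X) ^ d) = d.factorial / poch (a + 1) (d + 1) := by
  induction d generalizing a with
  | zero =>
    have := wInt_monomial a 0 1
    simp [poch_succ, poch_zero] at this ⊢
    exact this
  | succ d ih =>
    have h := wInt_by_parts ha ((1 - X) ^ (d + 1))
    have e : X * derivative ((1 - X : ℝ[X]) ^ (d + 1)) = C (-((d : ℝ) + 1)) * (X * (1 - X) ^ d) := by
      rw [derivative_pow]; simp; ring
    rw [e, wInt_C_mul, wInt_X_mul, ih (by linarith)] at h
    simp at h
    rw [poch_succ_left, Nat.factorial_succ]
    have h1 : poch (a + 1 + 1) (d + 1) ≠ 0 := (poch_pos (by linarith) _).ne'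
    have h2 : a + 1 ≠ 0 := by linarith
    push_cast
    field_simp at h ⊢
    linarith

/-- Integration by parts with `jac_adjoint`; the boundary term at 1 is killed by (1-x)^(d+1). Each
use trades one degree of the Jacobi polynomial for a derivative of q. Iteration gives orthogonality
to lower degrees, and the norm when q is the Jacobi polynomial itself. -/
theorem wInt_jac_mul {a : ℝ} (ha : -1 < a) (m d : ℕ) (q : ℝ[X]) :
    ((m : ℝ) + 1) * wInt a ((1 - X) ^ d * (jac (m + 1) a d * q))
      = - wInt (a + 1) ((1 - X) ^ (d + 1) * (jac m (a + 1) (d + 1 : ℕ) * derivative q)) := by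
  have h := wInt_by_parts ha ((1 - X) ^ (d + 1) * (jac m (a + 1) (d + 1 : ℕ) * q))
  simp only [eval_mul, eval_pow, eval_sub, eval_one, eval_X, sub_self, zero_pow (Nat.succ_ne_zero d),
    zero_mul] at h
  have hB := jac_adjoint m a d
  rw [← Nat.cast_succ] at hB
  have e : C (a + 1) * ((1 - X) ^ (d + 1) * (jac m (a + 1) (d + 1 : ℕ) * q))
      + X * derivative ((1 - X) ^ (d + 1) * (jac m (a + 1) (d + 1 : ℕ) * q))
      = C ((m : ℝ) + 1) * ((1 - X) ^ d * (jac (m + 1) a d * q))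
        + X * ((1 - X) ^ (d + 1) * (jac m (a + 1) (d + 1 : ℕ) * derivative q)) := by
    have hd : derivative ((1 - X : ℝ[X]) ^ (d + 1)) = - (C ((d + 1 : ℕ) : ℝ) * (1 - X) ^ d) := by
      rw [derivative_pow]; simp
    rw [derivative_mul, derivative_mul, hd]
    linear_combination ((1 - X) ^ d * q) * hB
  rw [← wInt_C_mul, ← map_add, e, map_add, wInt_C_mul, wInt_X_mul] at h
  linarith

theorem wInt_jac_mul_eq_zero {a : ℝ} (ha : -1 < a) (m d : ℕ) (q : ℝ[X]) (hq : q.natDegree < m) :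
    wInt a ((1 - X) ^ d * (jac m a d * q)) = 0 := by
  induction m generalizing a d q with
  | zero => simp at hq
  | succ m ih =>
    have h := wInt_jac_mul ha m d q
    have : wInt (a + 1) ((1 - X) ^ (d + 1) * (jac m (a + 1) (d + 1 : ℕ) * derivative q)) = 0 := by
      rcases Nat.eq_zero_or_pos q.natDegree with h0 | h0
      · rw [derivative_of_natDegree_zero h0]; simp
      · apply ih (by linarith)
        have := natDegree_derivative_lt h0.ne'
        omega
    rw [this, neg_zero] at h
    have hm : (m : ℝ) + 1 ≠ 0 := by positivity
    exact (mul_eq_zero.1 h).resolve_left hm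

theorem wInt_jac_sq {a : ℝ} (ha : -1 < a) (m d : ℕ) :
    wInt a ((1 - X) ^ d * (jac m a d * jac m a d))
      = poch (m + 1) d / (poch (m + a + 1) d * (2 * m + a + d + 1)) := by
  induction m generalizing a d with
  | zero =>
    rw [jac_zero, mul_one, mul_one, wInt_one_sub_pow ha, poch_succ]
    have : ((d.factorial : ℕ) : ℝ) = poch 1 d := by
      induction d with
      | zero => simp [poch_zero]
      | succ d ih => rw [poch_succ, ← ih, Nat.factorial_succ]; push_cast; ring
    rw [this]; simp; congr 2; ring
  | succ m ih =>
    have h := wInt_jac_mul ha m d (jac (m + 1) a d)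
    have e0 : (1 - X : ℝ[X]) ^ (d + 1) * (jac m (a + 1) (d + 1 : ℕ) * derivative (jac (m + 1) a d))
        = C (-((m : ℝ) + a + d + 2)) * ((1 - X) ^ (d + 1) *
          (jac m (a + 1) (d + 1 : ℕ) * jac m (a + 1) (d + 1 : ℕ))) := by
      rw [derivative_jac, Nat.cast_succ]; ring
    rw [e0, wInt_C_mul, ih (by linarith)] at h
    have hm : (m : ℝ) + 1 ≠ 0 := by positivity
    have hd : (0:ℝ) ≤ d := by positivity
    have hm0 : (0:ℝ) ≤ m := by positivity
    have h1 : (m : ℝ) + a + d + 2 ≠ 0 := by linarith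
    have h2 : 2 * (m : ℝ) + a + d + 3 ≠ 0 := by linarith
    have h3 : poch (((m + 1 : ℕ) : ℝ) + a + 1) d ≠ 0 :=
      (poch_pos (by push_cast; linarith) _).ne'
    have e1 : poch ((m : ℝ) + 1) (d + 1) = (m + 1) * poch (((m + 1 : ℕ) : ℝ) + 1) d := by
      rw [poch_succ_left]; push_cast; ring
    have e2 : poch ((m : ℝ) + (a + 1) + 1) (d + 1)
        = poch (((m + 1 : ℕ) : ℝ) + a + 1) d * (m + a + d + 2) := by
      rw [poch_succ]
      have : (m : ℝ) + (a + 1) + 1 = ((m + 1 : ℕ) : ℝ) + a + 1 := by push_cast; ring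
      rw [this]; push_cast; ring
    rw [e1, e2] at h
    apply mul_left_cancel₀ hm
    rw [h]
    have e3 : 2 * (m : ℝ) + (a + 1) + ((d + 1 : ℕ) : ℝ) + 1 = 2 * m + a + d + 3 := by
      push_cast; ring
    have e4 : 2 * ((m + 1 : ℕ) : ℝ) + a + d + 1 = 2 * m + a + d + 3 := by push_cast; ring
    rw [e3, e4]
    field_simp

/-- The remainder of division by X - 1 is the value at 1. The alternative q = 0 covers m = 0, where
no `natDegree` is below m. -/
theorem exists_eq_eval_one_add (p : ℝ[X]) (m : ℕ) (hp : p.natDegree ≤ m) :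
    ∃ q : ℝ[X], (q = 0 ∨ q.natDegree < m) ∧ p = C (p.eval 1) + (1 - X) * q := by
  rcases Nat.eq_zero_or_pos m with rfl | hm
  · refine ⟨0, Or.inl rfl, ?_⟩
    rw [eq_C_of_natDegree_le_zero hp]; simp
  refine ⟨-(p /ₘ (X - C 1)), Or.inr ?_, ?_⟩
  · rw [natDegree_neg, natDegree_divByMonic _ (monic_X_sub_C 1), natDegree_X_sub_C]
    omega
  · have h := modByMonic_add_div p (X - C (1:ℝ))
    rw [modByMonic_X_sub_C_eq_C_eval] at h
    conv_lhs => rw [← h]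
    simp only [C_1]; ring

/-- The weighted `L²` norm of the gradient of a radial Jacobi polynomial. -/
theorem wInt_jac_deriv_sq {a : ℝ} (ha : -1 < a) (m : ℕ) :
    (m + a + 2) * wInt a ((1 - X) * (jac m (a + 1) 1 * jac m (a + 1) 1)) * (a + 1) = m + 1 := by
  set E := jac m (a + 1) 1 with hE
  set F := jac (m + 1) a 0 with hF
  -- E is orthogonal to lower degrees for x^(a+1) (1-x), while the integral sought has x^a (1-x).
  -- The next steps move it to weights where orthogonality applies.
  have orth : ∀ q : ℝ[X], (q = 0 ∨ q.natDegree < m) → wInt (a + 1) ((1 - X) * (E * q)) = 0 := by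
    rintro q (rfl | hq)
    · simp
    · have := wInt_jac_mul_eq_zero (a := a + 1) (by linarith) m 1 q hq
      simpa [hE] using this
  -- By parts; the term with E E' drops out by orthogonality, as E' has lower degree.
  have h1 : (a + 1) * wInt a ((1 - X) * (E * E)) = wInt (a + 1) (E * E) := by
    have h := wInt_by_parts ha ((1 - X) * (E * E))
    have e : X * derivative ((1 - X) * (E * E))
        = X * (C 2 * ((1 - X) * (E * derivative E)) - E * E) := by
      have : (C 2 : ℝ[X]) = 2 := rfl
      simp [derivative_mul, this]; ring
    have z : wInt (a + 1) ((1 - X) * (E * derivative E)) = 0 := by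
      apply orth
      rcases Nat.eq_zero_or_pos E.natDegree with h0 | h0
      · exact Or.inl (derivative_of_natDegree_zero h0)
      · right
        have := natDegree_derivative_lt h0.ne'
        have : E.natDegree ≤ m := natDegree_jac_le m (a + 1) 1
        omega
    rw [e, wInt_X_mul, map_sub, wInt_C_mul, z] at h
    simp at h
    linarith
  have h2 : wInt (a + 1) (E * E) = E.eval 1 * wInt (a + 1) E := by
    obtain ⟨q, hq, he⟩ := exists_eq_eval_one_add E m (natDegree_jac_le m _ _)
    have : E * E = C (E.eval 1) * E + (1 - X) * (E * q) := by
      nth_rewrite 2 [he]; ring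
    rw [this, map_add, wInt_C_mul, orth q hq, add_zero]
  -- E is a multiple of F', and F integrates to zero against x^a, so only the boundary value F(1)
  -- remains.
  have h3 : (m + a + 2) * wInt (a + 1) E = - F.eval 1 := by
    have hd := derivative_jac m a 0
    rw [zero_add, add_zero] at hd
    have h := wInt_by_parts ha F
    have hz := wInt_jac_mul_eq_zero ha (m + 1) 0 1 (by simp)
    simp at hz
    rw [hF, hz, hd, wInt_X_mul, wInt_C_mul] at h
    linarith
  have h4 : ((m : ℝ) + 1) * F.eval 1 = - E.eval 1 := by
    have := eval_one_jac_succ m a 0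
    simpa using this
  have h5 : F.eval 1 ^ 2 = 1 := by
    rw [hF, eval_one_jac_sq]
    have : poch (0 + 1) (m + 1) = ((m + 1).factorial : ℕ) := by
      generalize m + 1 = n
      induction n with
      | zero => simp [poch_zero]
      | succ d ih => rw [poch_succ, ih, Nat.factorial_succ]; push_cast; ring
    rw [this, div_self (by positivity)]; norm_num
  calc _ = (m + a + 2) * ((a + 1) * wInt a ((1 - X) * (E * E))) := by ring
    _ = E.eval 1 * ((m + a + 2) * wInt (a + 1) E) := by rw [h1, h2]; ring
    _ = (m + 1) * F.eval 1 ^ 2 := by rw [h3]; linear_combination (- F.eval 1) * h4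
    _ = _ := by rw [h5, mul_one]

/-! ### Connection formula between the first parameters a - l and a -/

/-- The coefficients of the expansion of `jac n (a - l) 0` in the polynomials `jac (n - k) a 0`. -/
def connCoeff (a : ℝ) (l n k : ℕ) : ℝ :=
  (-1) ^ k * l.choose k * poch (n + a - l + 1) (l - k) * n.descFactorial k
    * (2 * n + a - 2 * k + 1) / poch (2 * n + a - l - k + 1) (l + 1)

/-- The recursion that the contiguous relation with parameter a - l imposes on the coefficients.
Apart from elementary factors it is Pascal's rule in l. -/
theorem connCoeff_succ_succ (a : ℝ) (l n k : ℕ) (hk : k ≤ l)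
    (hp : 0 < 2 * (n : ℝ) + a - 2 * l + 1) :
    (2 * n + 2 + a - l) * connCoeff a (l + 1) (n + 1) (k + 1)
      = (n + 1 + a - l) * connCoeff a l (n + 1) (k + 1) - (n + 1) * connCoeff a l n k := by
  -- The three denominators are subproducts of x (x+1) ... (x+1+l). The hypothesis makes x, the
  -- smallest factor, positive.
  obtain ⟨x, hx⟩ : ∃ x : ℝ, x = 2 * n + a - l - k + 1 := ⟨_, rfl⟩
  have hx0 : 0 < x := by
    have : (k : ℝ) ≤ l := by exact_mod_cast hk
    linarith
  have d1 : poch (2 * (n : ℝ) + a - l - k + 1) (l + 1) = x * poch (x + 1) l := by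
    rw [← hx, poch_succ_left]
  have d2 : poch (2 * ((n + 1 : ℕ) : ℝ) + a - l - ((k + 1 : ℕ) : ℝ) + 1) (l + 1)
      = poch (x + 1) l * (x + 1 + l) := by
    rw [← poch_succ]; congr 1; rw [hx]; push_cast; ring
  have d3 : poch (2 * ((n + 1 : ℕ) : ℝ) + a - ((l + 1 : ℕ) : ℝ) - ((k + 1 : ℕ) : ℝ) + 1) (l + 1 + 1)
      = x * poch (x + 1) l * (x + 1 + l) := by
    rw [mul_assoc, ← poch_succ, ← poch_succ_left]; congr 1; rw [hx]; push_cast; ring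
  have p1 : poch (((n + 1 : ℕ) : ℝ) + a - ((l + 1 : ℕ) : ℝ) + 1) (l + 1 - (k + 1))
      = poch (n + a - l + 1) (l - k) := by
    rw [Nat.add_sub_add_right]; congr 1; push_cast; ring
  have p2 : (n + 1 + a - l) * (l.choose (k + 1) * poch (((n + 1 : ℕ) : ℝ) + a - l + 1) (l - (k + 1)))
      = l.choose (k + 1) * poch (n + a - l + 1) (l - k) := by
    rcases Nat.lt_or_eq_of_le hk with h | h
    · obtain ⟨r, rfl⟩ := Nat.exists_eq_add_of_lt h
      rw [show k + r + 1 - k = r + 1 by omega, show k + r + 1 - (k + 1) = r by omega,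
        poch_succ_left]
      have : ((n + 1 : ℕ) : ℝ) + a - ((k + r + 1 : ℕ) : ℝ) + 1
        = n + a - ((k + r + 1 : ℕ) : ℝ) + 1 + 1 := by push_cast; ring
      rw [this]; ring
    · subst h; simp
  have c1 : ((l : ℝ) + 1) * l.choose k = (l + 1).choose (k + 1) * (k + 1) := by
    exact_mod_cast Nat.add_one_mul_choose_eq l k
  have c2 := choose_succ_cast l k
  have hY : poch (x + 1) l ≠ 0 := (poch_pos (by linarith) _).ne'
  have hz : x + 1 + l ≠ 0 := by positivity
  have hn : ((n + 1).descFactorial (k + 1) : ℝ) = (n + 1) * n.descFactorial k := by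
    rw [Nat.succ_descFactorial_succ]; push_cast; ring
  simp only [connCoeff, d1, d2, d3, p1, hn]
  have hx1 := hx0.ne'
  have e : 2 * (n : ℝ) + 2 + a - l = x + k + 1 := by rw [hx]; ring
  rw [c2] at c1
  rw [e, c2]
  push_cast
  have e2 : 2 * ((n : ℝ) + 1) + a - 2 * (k + 1) + 1 = 2 * n + a - 2 * k + 1 := by ring
  rw [e2]
  field_simp
  rw [pow_succ]
  set P := poch ((n : ℝ) + a - l + 1) (l - k)
  push_cast at p2
  set W := (n.descFactorial k : ℝ) * (2 * n + a - 2 * k + 1)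
  linear_combination (-1 : ℝ) ^ k * W * x * p2 + (-1 : ℝ) ^ k * W * P * c1

theorem connCoeff_succ_zero (a : ℝ) (l n : ℕ) (hp : 0 < 2 * (n : ℝ) + a - 2 * l + 1) :
    (2 * n + 2 + a - l) * connCoeff a (l + 1) (n + 1) 0
      = (n + 1 + a - l) * connCoeff a l (n + 1) 0 := by
  obtain ⟨x, hx⟩ : ∃ x : ℝ, x = 2 * n + a - l + 2 := ⟨_, rfl⟩
  have hx0 : 0 < x := by
    have : (0 : ℝ) ≤ l := by positivity
    linarith
  have d2 : poch (2 * ((n + 1 : ℕ) : ℝ) + a - l - ((0 : ℕ) : ℝ) + 1) (l + 1)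
      = poch (x + 1) (l + 1) := by
    congr 1; rw [hx]; push_cast; ring
  have d3 : poch (2 * ((n + 1 : ℕ) : ℝ) + a - ((l + 1 : ℕ) : ℝ) - ((0 : ℕ) : ℝ) + 1) (l + 1 + 1)
      = x * poch (x + 1) (l + 1) := by
    rw [← poch_succ_left]; congr 1; rw [hx]; push_cast; ring
  have p1 : poch (((n + 1 : ℕ) : ℝ) + a - ((l + 1 : ℕ) : ℝ) + 1) (l + 1 - 0)
      = (n + 1 + a - l) * poch (((n + 1 : ℕ) : ℝ) + a - l + 1) (l - 0) := by
    rw [Nat.sub_zero, Nat.sub_zero, poch_succ_left]; push_cast; congr 1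
    · ring
    · congr 1; ring
  have hY : poch (x + 1) (l + 1) ≠ 0 := (poch_pos (by linarith) _).ne'
  simp only [connCoeff, d2, d3, p1]
  have e : 2 * (n : ℝ) + 2 + a - l = x := by rw [hx]; ring
  rw [e]
  simp
  field_simp

theorem jac_connection (a : ℝ) (l n : ℕ) (hl : l ≤ n) (hp : -1 < 2 * (n : ℝ) + a - 2 * l) :
    jac n (a - l) 0 = ∑ k ∈ Finset.range (l + 1), C (connCoeff a l n k) * jac (n - k) a 0 := by
  induction l generalizing n with
  | zero =>
    have : 2 * (n : ℝ) + a + 1 ≠ 0 := by simp at hp; linarith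
    simp [connCoeff, poch_succ, poch_zero]
    field_simp
    simp
  | succ l ih =>
    obtain ⟨n, rfl⟩ : ∃ m, n = m + 1 := ⟨n - 1, by omega⟩
    push_cast at hp
    have hD := jac_contiguous n (a - l) 0
    have h1 := ih (n + 1) (by omega) (by push_cast; linarith)
    have h2 := ih n (by omega) (by linarith)
    have hc : (2 * (n : ℝ) + 2 + (a - l) + 0) ≠ 0 := by
      have : (0 : ℝ) ≤ l := by positivity
      linarith
    have e : a - ((l + 1 : ℕ) : ℝ) = a - l - 1 := by push_cast; ring
    rw [e]
    apply mul_left_cancel₀ (C_ne_zero.2 hc)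
    rw [hD, h1, h2, Finset.sum_range_succ' _ (l + 1)]
    -- The binomial coefficient vanishes at k = l + 1, so the sum for degree n + 1 can be extended
    -- by one term, the term k = 0 split off and the rest shifted to align with the sum for degree
    -- n.
    have hlast : connCoeff a l (n + 1) (l + 1) = 0 := by simp [connCoeff]
    have e1 : ∑ k ∈ Finset.range (l + 1), C (connCoeff a l (n + 1) k) * jac (n + 1 - k) a 0
        = ∑ k ∈ Finset.range (l + 1), C (connCoeff a l (n + 1) (k + 1)) * jac (n - k) a 0
          + C (connCoeff a l (n + 1) 0) * jac (n + 1) a 0 := by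
      have := Finset.sum_range_succ (fun k => C (connCoeff a l (n + 1) k) * jac (n + 1 - k) a 0)
        (l + 1)
      rw [hlast, C_0, zero_mul, add_zero] at this
      rw [← this, Finset.sum_range_succ']
      simp only [Nat.add_sub_add_right, Nat.sub_zero]
    rw [e1, mul_add, mul_add, add_sub_right_comm, Finset.mul_sum, Finset.mul_sum, Finset.mul_sum,
      ← Finset.sum_sub_distrib]
    congr 1
    · refine Finset.sum_congr rfl fun k hk => ?_
      have := connCoeff_succ_succ a l n k (by simp at hk; omega) (by linarith)
      rw [Nat.add_sub_add_right, ← mul_assoc, ← mul_assoc, ← mul_assoc, ← sub_mul, ← C_mul, ← C_mul,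
        ← C_mul, ← C_sub]
      congr 2
      linear_combination -this
    · have := connCoeff_succ_zero a l n (by linarith)
      rw [← mul_assoc, ← mul_assoc, ← C_mul, ← C_mul, Nat.sub_zero]
      congr 2
      linear_combination -this

/-! ### Identification of t_j with a single Jacobi polynomial -/

/-- The radial function `Q (1 - |z|²)`. -/
def radial (Q : ℝ[X]) (z : ℂ) : ℂ := ((Q.eval (1 - ‖z‖ ^ 2) : ℝ) : ℂ)

theorem poch_neg_natCast {n k : ℕ} (hk : k ≤ n) :
    poch (-n) k = (-1) ^ k * k.factorial * n.choose k := by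
  have h1 : poch (-n) k = (-1) ^ k * n.descFactorial k := by
    induction k with
    | zero => simp [poch_zero]
    | succ k ih =>
      rw [poch_succ, ih (by omega), Nat.descFactorial_succ]
      push_cast [Nat.cast_sub (show k ≤ n by omega)]
      ring
  rw [h1, Nat.descFactorial_eq_factorial_mul_choose]
  push_cast; ring

theorem Gamma_add_natCast {x : ℝ} (hx : 0 < x) (n : ℕ) :
    Real.Gamma (x + n) = Real.Gamma x * poch x n := by
  induction n with
  | zero => simp [poch_zero]
  | succ n ih =>
    rw [poch_succ, ← mul_assoc, ← ih, Nat.cast_succ, ← add_assoc, Real.Gamma_add_one (by positivity)]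
    ring

theorem jacobi_eq_eval {α : ℝ} (hα : -1 < α) (n : ℕ) (x : ℝ) :
    jacobi α 0 n x = (jac n α 0).eval ((1 - x) / 2) := by
  rw [jacobi, jac, eval_finsetSum, Finset.mul_sum]
  refine Finset.sum_congr rfl fun k hk => ?_
  have hk' : k ≤ n := by simp at hk; omega
  rw [eval_monomial, jacCoeff, poch_neg_natCast hk']
  obtain ⟨r, rfl⟩ := Nat.exists_eq_add_of_le hk'
  rw [poch_add, Nat.add_sub_cancel_left]
  have h1 : poch (α + 1) k ≠ 0 := (poch_pos (by linarith) _).ne'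
  have e1 : α + (k : ℝ) + 1 = α + 1 + k := by ring
  rw [e1]
  field_simp

theorem zernike_diag {α : ℝ} (hα : -1 < α) (n : ℕ) (z : ℂ) :
    zernike α n n z = ((Real.Gamma (n + 1) * Real.Gamma (α + 1) / Real.Gamma (n + α + 1) : ℝ) : ℂ) *
      radial (jac n α 0) z := by
  simp only [zernike, radial, min_self, sub_self, Int.natAbs_zero, pow_zero, mul_one]
  rw [Nat.cast_zero, jacobi_eq_eval hα]
  have : (1 - (2 * ‖z‖ ^ 2 - 1)) / 2 = 1 - ‖z‖ ^ 2 := by ring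
  rw [this]; simp

/-- The ratio of `tPoly α l j` to the Jacobi polynomial of degree `j + l` with parameters
`(α - l, 0)`. -/
def tScale (α : ℝ) (l j : ℕ) : ℝ :=
  Real.Gamma (α + 1) * Real.Gamma (j + α + 1) / (j + l).factorial

theorem tScale_pos {α : ℝ} (hα : -1 < α) (l j : ℕ) : 0 < tScale α l j := by
  have h1 : (0 : ℝ) ≤ j := by positivity
  have := Real.Gamma_pos_of_pos (show 0 < α + 1 by linarith)
  have := Real.Gamma_pos_of_pos (show 0 < (j : ℝ) + α + 1 by linarith)
  unfold tScale
  positivity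

/-- The Zernike normalization cancels one of the two Gamma factors in the numerator; the other
splits as Γ(j+α+1), which is independent of k, times the Pochhammer symbol of the connection
coefficient. -/
theorem tCoeff_eq {α : ℝ} (hα : -1 < α) (l j k : ℕ) (hk : k ≤ l) :
    tCoeff α l j k * (Real.Gamma ((j + l - k : ℕ) + 1) * Real.Gamma (α + 1) /
      Real.Gamma ((j + l - k : ℕ) + α + 1)) = tScale α l j * connCoeff α l (j + l) k := by
  obtain ⟨r, rfl⟩ := Nat.exists_eq_add_of_le hk
  have hj : (0 : ℝ) ≤ j := by positivity
  have e0 : j + (k + r) - k = j + r := by omega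
  have hg : Real.Gamma (α + j + r + 1) = Real.Gamma (j + α + 1) * poch (j + α + 1) r := by
    rw [← Gamma_add_natCast (by linarith)]; congr 1; ring
  have hg0 := (Real.Gamma_pos_of_pos (show 0 < (j : ℝ) + α + 1 by linarith)).ne'
  have hp0 : poch (j + α + 1) r ≠ 0 := (poch_pos (by linarith) r).ne'
  have a1 : α + (j : ℝ) + ((k + r : ℕ) : ℝ) - k + 1 = α + j + r + 1 := by push_cast; ring
  have a2 : (j : ℝ) + ((k + r : ℕ) : ℝ) - k + 1 = ((j + r : ℕ) : ℝ) + 1 := by push_cast; ring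
  have a3 : ((j + r : ℕ) : ℝ) + α + 1 = α + j + r + 1 := by push_cast; ring
  have a4 : α + 2 * (j : ℝ) + 2 * ((k + r : ℕ) : ℝ) - 2 * k + 1 = α + 2 * j + 2 * r + 1 := by
    push_cast; ring
  have a5 : α + 2 * (j : ℝ) + ((k + r : ℕ) : ℝ) - k + 1 = α + 2 * j + r + 1 := by
    push_cast; ring
  have b1 : ((j + (k + r) : ℕ) : ℝ) + α - ((k + r : ℕ) : ℝ) + 1 = j + α + 1 := by push_cast; ring
  have b2 : 2 * ((j + (k + r) : ℕ) : ℝ) + α - 2 * k + 1 = α + 2 * j + 2 * r + 1 := by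
    push_cast; ring
  have b3 : 2 * ((j + (k + r) : ℕ) : ℝ) + α - ((k + r : ℕ) : ℝ) - k + 1 = α + 2 * j + r + 1 := by
    push_cast; ring
  have hdf : (((j + (k + r)).factorial : ℕ) : ℝ)
      = (j + r).factorial * (j + (k + r)).descFactorial k := by
    have := Nat.factorial_mul_descFactorial (show k ≤ j + (k + r) by omega)
    rw [e0] at this
    exact_mod_cast this.symm
  have hd0 : (((j + (k + r)).descFactorial k : ℕ) : ℝ) ≠ 0 := by
    have := Nat.descFactorial_pos.2 (show k ≤ j + (k + r) by omega)
    positivity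
  have hf0 : ((j + r).factorial : ℝ) ≠ 0 := by positivity
  rw [tCoeff, tScale, connCoeff, poch_neg_natCast hk, e0, a1, a2, a3, a4, a5, b1, b2, b3, hdf, hg,
    Real.Gamma_nat_eq_factorial, Real.Gamma_nat_eq_factorial, Nat.add_sub_cancel_left]
  -- Both sides have this same denominator, so its nonvanishing is not needed: for D = 0 both are
  -- zero by the convention for division.
  generalize poch (α + 2 * (j : ℝ) + r + 1) (k + r + 1) = D
  by_cases hD : D = 0
  · simp [hD]
  field_simp

/-- The coefficients of t_j are exactly those of the connection formula from α - l to α, up to the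
factor `tScale`. -/
theorem tPoly_eq {α : ℝ} (hα : -1 < α) (l j : ℕ) :
    tPoly α l j = fun z => (tScale α l j : ℂ) * radial (jac (j + l) (α - l) 0) z := by
  funext z
  have hj : (0 : ℝ) ≤ j := by positivity
  rw [tPoly, jac_connection α l (j + l) (by omega) (by push_cast; linarith), radial,
    eval_finsetSum, Complex.ofReal_sum, Finset.mul_sum]
  refine Finset.sum_congr rfl fun k hk => ?_
  have hk' : k ≤ l := by simp at hk; omega
  rw [zernike_diag hα, ← mul_assoc, ← Complex.ofReal_mul, tCoeff_eq hα l j k hk', eval_mul, eval_C,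
    radial]
  push_cast; ring

/-! ### The weighted measure and integrals of radial functions -/

theorem image_one_sub_sq : (fun y : ℝ => 1 - y ^ 2) '' Set.Ioo 0 1 = Set.Ioo 0 1 := by
  ext x
  constructor
  · rintro ⟨y, ⟨h0, h1⟩, rfl⟩
    exact ⟨by dsimp only; nlinarith, by dsimp only; nlinarith⟩
  · rintro ⟨h0, h1⟩
    refine ⟨√(1 - x), ⟨Real.sqrt_pos.2 (by linarith), ?_⟩, ?_⟩
    · rw [Real.sqrt_lt' one_pos]; linarith
    · dsimp only; rw [Real.sq_sqrt (by linarith)]; ring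

theorem hasDerivWithinAt_one_sub_sq (y : ℝ) (s : Set ℝ) :
    HasDerivWithinAt (fun y : ℝ => 1 - y ^ 2) (-(2 * y)) s y := by
  have := ((hasDerivAt_pow 2 y).const_sub 1).hasDerivWithinAt (s := s)
  simpa using this

theorem injOn_one_sub_sq : Set.InjOn (fun y : ℝ => 1 - y ^ 2) (Set.Ioo 0 1) := by
  intro x hx y hy h
  have : x ^ 2 = y ^ 2 := by dsimp only at h; linarith
  exact (pow_left_inj₀ hx.1.le hy.1.le two_ne_zero).1 this

theorem integrableOn_Ioo_rpow {β : ℝ} (hβ : -1 < β) :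
    IntegrableOn (fun x : ℝ => x ^ β) (Set.Ioo 0 1) := by
  rw [← intervalIntegrable_iff_integrableOn_Ioo_of_le zero_le_one]
  exact intervalIntegral.intervalIntegrable_rpow' hβ

theorem integral_Ioo_rpow {β : ℝ} (hβ : -1 < β) :
    ∫ x in Set.Ioo (0 : ℝ) 1, x ^ β = 1 / (β + 1) := by
  rw [← integral_Ioc_eq_integral_Ioo, ← intervalIntegral.integral_of_le zero_le_one,
    integral_rpow (Or.inl hβ), Real.one_rpow, Real.zero_rpow (by linarith), sub_zero]

theorem integrableOn_radial_weight {β : ℝ} (hβ : -1 < β) :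
    IntegrableOn (fun y : ℝ => y * (1 - y ^ 2) ^ β) (Set.Ioo 0 1) := by
  have h := integrableOn_image_iff_integrableOn_abs_deriv_smul measurableSet_Ioo
    (fun x _ => hasDerivWithinAt_one_sub_sq x _) injOn_one_sub_sq (fun x : ℝ => x ^ β)
  rw [image_one_sub_sq] at h
  refine IntegrableOn.congr_fun ((h.1 (integrableOn_Ioo_rpow hβ)).const_mul (1 / 2)) ?_
    measurableSet_Ioo
  intro y hy
  simp only [abs_neg, smul_eq_mul, abs_of_pos (show 0 < 2 * y by linarith [hy.1])]
  ring

theorem integral_radial_weight {β : ℝ} (hβ : -1 < β) :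
    ∫ y in Set.Ioo (0 : ℝ) 1, y * (1 - y ^ 2) ^ β = 1 / (2 * (β + 1)) := by
  have h := integral_image_eq_integral_abs_deriv_smul measurableSet_Ioo
    (fun x _ => hasDerivWithinAt_one_sub_sq x _) injOn_one_sub_sq (fun x : ℝ => x ^ β)
  rw [image_one_sub_sq, integral_Ioo_rpow hβ] at h
  have e : ∫ y in Set.Ioo (0 : ℝ) 1, |-(2 * y)| • (1 - y ^ 2) ^ β
      = ∫ y in Set.Ioo (0 : ℝ) 1, 2 * (y * (1 - y ^ 2) ^ β) := by
    refine setIntegral_congr_fun measurableSet_Ioo fun y hy => ?_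
    simp only [abs_neg, smul_eq_mul, abs_of_pos (show 0 < 2 * y by linarith [hy.1])]
    ring
  rw [e, integral_const_mul] at h
  have : β + 1 ≠ 0 := by linarith
  field_simp at h ⊢
  linarith

theorem measurable_weight (α : ℝ) :
    Measurable fun z : ℂ => ENNReal.ofReal ((1 - ‖z‖ ^ 2) ^ α) := by
  fun_prop

theorem one_sub_norm_sq_pos {z : ℂ} (hz : z ∈ disk) : 0 < 1 - ‖z‖ ^ 2 := by
  have : ‖z‖ < 1 := by simpa [disk] using hz
  nlinarith [norm_nonneg z]

theorem measurableSet_disk : MeasurableSet disk := measurableSet_ball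

theorem ae_mem_disk (α : ℝ) : ∀ᵐ z ∂(wMeasure α), z ∈ disk :=
  (withDensity_absolutelyContinuous _ _).ae_le (ae_restrict_mem measurableSet_disk)

/-- The density is positive on the disk, so the weighted and the unweighted measure have the same
null sets there. -/
theorem ae_wMeasure_iff (α : ℝ) (p : ℂ → Prop) :
    (∀ᵐ z ∂(wMeasure α), p z) ↔ ∀ᵐ z ∂(volume.restrict disk), p z := by
  refine ⟨fun h => ?_, fun h => (withDensity_absolutelyContinuous _ _).ae_le h⟩
  refine (withDensity_absolutelyContinuous' (measurable_weight α).aemeasurable ?_).ae_le h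
  filter_upwards [ae_restrict_mem measurableSet_disk] with z hz
  simpa using Real.rpow_pos_of_pos (one_sub_norm_sq_pos hz) α

theorem toReal_weight_smul_ae (α : ℝ) (f : ℂ → ℂ) :
    (fun z : ℂ => (ENNReal.ofReal ((1 - ‖z‖ ^ 2) ^ α)).toReal • f z)
      =ᵐ[volume.restrict disk] fun z => (1 - ‖z‖ ^ 2) ^ α • f z := by
  filter_upwards [ae_restrict_mem measurableSet_disk] with z hz
  rw [ENNReal.toReal_ofReal (Real.rpow_pos_of_pos (one_sub_norm_sq_pos hz) α).le]

theorem integral_wMeasure (α : ℝ) (f : ℂ → ℂ) :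
    ∫ z, f z ∂(wMeasure α) = ∫ z in disk, (1 - ‖z‖ ^ 2) ^ α • f z := by
  rw [wMeasure, integral_withDensity_eq_integral_toReal_smul (measurable_weight α) (by simp)]
  exact integral_congr_ae (toReal_weight_smul_ae α f)

theorem integrable_wMeasure_iff (α : ℝ) (f : ℂ → ℂ) :
    Integrable f (wMeasure α) ↔ IntegrableOn (fun z => (1 - ‖z‖ ^ 2) ^ α • f z) disk := by
  rw [wMeasure, integrable_withDensity_iff_integrable_smul' (measurable_weight α) (by simp)]
  exact integrable_congr (toReal_weight_smul_ae α f)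

theorem isFiniteMeasure_wMeasure {α : ℝ} (hα : -1 < α) : IsFiniteMeasure (wMeasure α) := by
  have h : Integrable (fun _ : ℂ => (1 : ℂ)) (wMeasure α) := by
    rw [integrable_wMeasure_iff]
    have h := (integrableOn_fun_norm_addHaar (E := ℂ) volume
      (f := fun y : ℝ => ((1 - y ^ 2) ^ α) • (1 : ℂ)) (r := 1)).2 ?_
    · exact h
    · rw [Complex.finrank_real_complex]
      have := (integrableOn_radial_weight hα).smul_const (1 : ℂ)
      refine IntegrableOn.congr_fun this (fun y _ => ?_) measurableSet_Ioo
      simp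
  simpa [integrable_const_iff] using h

theorem exists_bound_on_disk {f : ℂ → ℂ} (hf : Continuous f) : ∃ C, ∀ z ∈ disk, ‖f z‖ ≤ C := by
  obtain ⟨C, hC⟩ := (isCompact_closedBall (0 : ℂ) 1).exists_bound_of_continuousOn hf.continuousOn
  exact ⟨C, fun z hz => hC z (Metric.ball_subset_closedBall hz)⟩

theorem memLp_wMeasure {α : ℝ} (hα : -1 < α) {f : ℂ → ℂ} (hf : Continuous f) (p : ℝ≥0∞) :
    MemLp f p (wMeasure α) := by
  have := isFiniteMeasure_wMeasure hα
  obtain ⟨C, hC⟩ := exists_bound_on_disk hf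
  refine MemLp.of_bound hf.aestronglyMeasurable C ?_
  filter_upwards [ae_mem_disk α] with z hz using hC z hz

theorem integrable_wMeasure {α : ℝ} (hα : -1 < α) {f : ℂ → ℂ} (hf : Continuous f) :
    Integrable f (wMeasure α) :=
  memLp_one_iff_integrable.1 (memLp_wMeasure hα hf 1)

theorem continuous_radial (Q : ℝ[X]) : Continuous (radial Q) := by
  unfold radial
  have := Q.continuous
  fun_prop

theorem radial_add (P Q : ℝ[X]) : radial (P + Q) = fun z => radial P z + radial Q z := by
  funext z; simp [radial]

theorem radial_mul (P Q : ℝ[X]) : radial (P * Q) = fun z => radial P z * radial Q z := by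
  funext z; simp [radial]

/-- A monomial x^k turns the weight exponent α into α + k, after which polar coordinates and the
substitution x = 1 - y² apply. The factor π is the area of the disk, the dimension 2 cancelling the
1/2 of the substitution. -/
theorem integral_radial {α : ℝ} (hα : -1 < α) (Q : ℝ[X]) :
    ∫ z, radial Q z ∂(wMeasure α) = ((Real.pi * wInt α Q : ℝ) : ℂ) := by
  induction Q using Polynomial.induction_on' with
  | add P Q hP hQ =>
    rw [radial_add, integral_add (integrable_wMeasure hα (continuous_radial P))
      (integrable_wMeasure hα (continuous_radial Q)), hP, hQ, map_add]
    push_cast; ring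
  | monomial k c =>
    rw [integral_wMeasure, wInt_monomial]
    have hk : -1 < α + k := by
      have : (0 : ℝ) ≤ k := by positivity
      linarith
    have e : ∫ z in disk, (1 - ‖z‖ ^ 2) ^ α • radial (monomial k c) z
        = ∫ z : ℂ, (((Set.Iio (1 : ℝ)).indicator (fun y => c * (1 - y ^ 2) ^ (α + k)) ‖z‖ : ℝ) : ℂ) := by
      rw [← integral_indicator measurableSet_disk]
      refine integral_congr_ae (Eventually.of_forall fun z => ?_)
      by_cases hz : z ∈ disk
      · have hz' : ‖z‖ ∈ Set.Iio (1 : ℝ) := by simpa [disk] using hz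
        simp only [Set.indicator_of_mem hz, Set.indicator_of_mem hz', radial, eval_monomial]
        rw [Real.rpow_add (one_sub_norm_sq_pos hz), Real.rpow_natCast, Complex.real_smul,
          ← Complex.ofReal_mul]
        congr 1; ring
      · have hz' : ‖z‖ ∉ Set.Iio (1 : ℝ) := by simpa [disk] using hz
        simp [Set.indicator_of_notMem hz, Set.indicator_of_notMem hz']
    rw [e, integral_complex_ofReal, integral_fun_norm_addHaar (E := ℂ) volume
      ((Set.Iio (1 : ℝ)).indicator (fun y => c * (1 - y ^ 2) ^ (α + k)))]
    congr 1
    have e2 : ∫ y in Set.Ioi (0 : ℝ), y ^ (Module.finrank ℝ ℂ - 1) •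
        (Set.Iio (1 : ℝ)).indicator (fun y => c * (1 - y ^ 2) ^ (α + k)) y
        = ∫ y in Set.Ioo (0 : ℝ) 1, c * (y * (1 - y ^ 2) ^ (α + k)) := by
      rw [← Set.Ioi_inter_Iio, Set.inter_comm, ← Measure.restrict_restrict measurableSet_Iio,
        ← integral_indicator (s := Set.Iio (1 : ℝ)) measurableSet_Iio]
      refine integral_congr_ae (Eventually.of_forall fun y => ?_)
      rw [Complex.finrank_real_complex]
      by_cases hy : y ∈ Set.Iio (1 : ℝ)
      · simp only [Set.indicator_of_mem hy, smul_eq_mul]; ring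
      · simp [Set.indicator_of_notMem hy]
    rw [e2, integral_const_mul, integral_radial_weight hk, Complex.finrank_real_complex]
    have hv : (volume : Measure ℂ).real (Metric.ball 0 1) = Real.pi := by
      simp [Measure.real, Complex.volume_ball]
    rw [hv]
    have : α + k + 1 ≠ 0 := by linarith
    simp only [smul_eq_mul, nsmul_eq_mul]
    push_cast
    field_simp

/-! ### Rotations and orthogonality of angular frequencies -/

theorem integral_comp_mul_circle (α : ℝ) (f : ℂ → ℂ) (η : Circle) :
    ∫ z, f (η * z) ∂(wMeasure α) = ∫ z, f z ∂(wMeasure α) := by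
  rw [integral_wMeasure, integral_wMeasure, ← integral_indicator measurableSet_disk,
    ← integral_indicator measurableSet_disk]
  have h := (rotation η).measurePreserving.integral_comp
    (rotation η).toHomeomorph.measurableEmbedding
    (disk.indicator fun z => (1 - ‖z‖ ^ 2) ^ α • f z)
  rw [← h]
  refine integral_congr_ae (Eventually.of_forall fun z => ?_)
  have hn : ‖(η : ℂ) * z‖ = ‖z‖ := by rw [norm_mul, Circle.norm_coe, one_mul]
  have hm : (η * z : ℂ) ∈ disk ↔ z ∈ disk := by simp only [disk, mem_ball_zero_iff, hn]
  by_cases hz : z ∈ disk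
  · simp only [Set.indicator_of_mem hz, Set.indicator_of_mem (hm.2 hz), rotation_apply, hn]
  · simp only [Set.indicator_of_notMem hz, Set.indicator_of_notMem (mt hm.1 hz), rotation_apply]

/-- `f` has angular frequency `m`. -/
def HasFreq (m : ℤ) (f : ℂ → ℂ) : Prop := ∀ (η : Circle) (z : ℂ), f (η * z) = (η : ℂ) ^ m * f z

theorem integral_mul_conj_eq_zero_of_freq (α : ℝ) {m n : ℤ} (hmn : m ≠ n) {f g : ℂ → ℂ}
    (hf : HasFreq m f) (hg : HasFreq n g) :
    ∫ z, f z * (starRingEnd ℂ) (g z) ∂(wMeasure α) = 0 := by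
  have hd : ((m - n : ℤ) : ℝ) ≠ 0 := by
    rw [Int.cast_ne_zero]; omega
  -- A rotation by this angle reverses the sign of the integrand, so the integral equals its own
  -- negative. Integrability plays no role.
  set η : Circle := Circle.exp (Real.pi / (m - n : ℤ))
  have hη : (η : ℂ) ^ (m - n) = -1 := by
    rw [Circle.coe_exp, ← Complex.exp_int_mul, ← Complex.exp_pi_mul_I]
    congr 1
    have : (((m - n : ℤ) : ℝ) : ℂ) ≠ 0 := by exact_mod_cast hd
    push_cast at this ⊢
    field_simp
  have h := integral_comp_mul_circle α (fun z => f z * (starRingEnd ℂ) (g z)) η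
  have e : ∀ z, f (η * z) * (starRingEnd ℂ) (g (η * z)) = -(f z * (starRingEnd ℂ) (g z)) := by
    intro z
    rw [hf, hg, map_mul, map_zpow₀, ← Circle.coe_inv_eq_conj, Circle.coe_inv, inv_zpow]
    have hw : (η : ℂ) ≠ 0 := Circle.coe_ne_zero η
    rw [zpow_sub₀ hw] at hη
    calc _ = ((η : ℂ) ^ m / (η : ℂ) ^ n) * (f z * (starRingEnd ℂ) (g z)) := by
          rw [div_eq_mul_inv]; ring
      _ = _ := by rw [hη]; ring
  simp only [e, integral_neg] at h
  exact self_eq_neg.1 h.symm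

/-! ### Classical derivatives of smooth functions as weak derivatives -/

theorem contDiff_dirDeriv {u : ℂ → ℂ} (hu : ContDiff ℝ ∞ u) (v : ℂ) :
    ContDiff ℝ ∞ (dirDeriv v u) :=
  (hu.fderiv_right (m := ∞) le_rfl).clm_apply contDiff_const

theorem contDiff_iterate_dirDeriv {u : ℂ → ℂ} (hu : ContDiff ℝ ∞ u) (v : ℂ) (n : ℕ) :
    ContDiff ℝ ∞ ((dirDeriv v)^[n] u) := by
  induction n with
  | zero => exact hu
  | succ n ih => rw [Function.iterate_succ_apply']; exact contDiff_dirDeriv ih v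

theorem contDiff_partialDeriv {u : ℂ → ℂ} (hu : ContDiff ℝ ∞ u) (a b : ℕ) :
    ContDiff ℝ ∞ (partialDeriv a b u) :=
  contDiff_iterate_dirDeriv (contDiff_iterate_dirDeriv hu _ _) _ _

theorem dirDeriv_comm {u : ℂ → ℂ} (hu : ContDiff ℝ ∞ u) (v w : ℂ) :
    dirDeriv v (dirDeriv w u) = dirDeriv w (dirDeriv v u) := by
  have hd : Differentiable ℝ (fderiv ℝ u) :=
    (hu.fderiv_right (m := ∞) le_rfl).differentiable (by simp)
  have key : ∀ v w z, dirDeriv v (dirDeriv w u) z = fderiv ℝ (fderiv ℝ u) z v w := by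
    intro v w z
    have := ((hd z).hasFDerivAt.clm_apply (hasFDerivAt_const w z)).fderiv
    change fderiv ℝ (fun y => fderiv ℝ u y w) z v = _
    rw [this]; simp
  funext z
  rw [key, key]
  have hs : IsSymmSndFDerivAt ℝ u z := hu.contDiffAt.isSymmSndFDerivAt (by
    simp only [minSmoothness_of_isRCLikeNormedField]; exact WithTop.coe_le_coe.2 le_top)
  exact hs v w

theorem iterate_dirDeriv_comm {u : ℂ → ℂ} (hu : ContDiff ℝ ∞ u) (v w : ℂ) (m n : ℕ) :
    (dirDeriv v)^[m] ((dirDeriv w)^[n] u) = (dirDeriv w)^[n] ((dirDeriv v)^[m] u) := by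
  have h1 : ∀ n : ℕ, ∀ u : ℂ → ℂ, ContDiff ℝ ∞ u →
      dirDeriv v ((dirDeriv w)^[n] u) = (dirDeriv w)^[n] (dirDeriv v u) := by
    intro n
    induction n with
    | zero => intro u _; rfl
    | succ n ih =>
      intro u hu
      rw [Function.iterate_succ_apply, Function.iterate_succ_apply, ih _ (contDiff_dirDeriv hu w),
        dirDeriv_comm hu]
  induction m generalizing u with
  | zero => rfl
  | succ m ih =>
    rw [Function.iterate_succ_apply, Function.iterate_succ_apply, h1 n u hu,
      ih (contDiff_dirDeriv hu v)]

theorem tsupport_dirDeriv_subset (v : ℂ) (φ : ℂ → ℂ) : tsupport (dirDeriv v φ) ⊆ tsupport φ :=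
  tsupport_fderiv_apply_subset ℝ v

theorem tsupport_iterate_dirDeriv_subset (v : ℂ) (n : ℕ) (φ : ℂ → ℂ) :
    tsupport ((dirDeriv v)^[n] φ) ⊆ tsupport φ := by
  induction n with
  | zero => exact subset_rfl
  | succ n ih =>
    rw [Function.iterate_succ_apply']
    exact (tsupport_dirDeriv_subset _ _).trans ih

theorem integral_mul_dirDeriv {u φ : ℂ → ℂ} (hu : ContDiff ℝ ∞ u) (hφ : ContDiff ℝ ∞ φ)
    (hc : HasCompactSupport φ) (v : ℂ) :
    ∫ z, u z * dirDeriv v φ z = - ∫ z, dirDeriv v u z * φ z := by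
  have hd : HasCompactSupport (dirDeriv v φ) :=
    hc.of_isClosed_subset (isClosed_tsupport _) (tsupport_dirDeriv_subset v φ)
  refine integral_mul_fderiv_eq_neg_fderiv_mul_of_integrable ?_ ?_ ?_ ?_ ?_
  · exact ((contDiff_dirDeriv hu v).continuous.mul hφ.continuous).integrable_of_hasCompactSupport
      hc.mul_left
  · exact (hu.continuous.mul (contDiff_dirDeriv hφ v).continuous).integrable_of_hasCompactSupport
      hd.mul_left
  · exact (hu.continuous.mul hφ.continuous).integrable_of_hasCompactSupport hc.mul_left
  · exact fun x _ => hu.differentiable (by simp) x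
  · exact fun x _ => hφ.differentiable (by simp) x

theorem integral_mul_iterate_dirDeriv {u φ : ℂ → ℂ} (hu : ContDiff ℝ ∞ u) (hφ : ContDiff ℝ ∞ φ)
    (hc : HasCompactSupport φ) (v : ℂ) (n : ℕ) :
    ∫ z, u z * (dirDeriv v)^[n] φ z = (-1) ^ n * ∫ z, (dirDeriv v)^[n] u z * φ z := by
  induction n generalizing u with
  | zero => simp
  | succ n ih =>
    have hd : HasCompactSupport ((dirDeriv v)^[n] φ) :=
      hc.of_isClosed_subset (isClosed_tsupport _) (tsupport_iterate_dirDeriv_subset v n φ)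
    simp only [Function.iterate_succ_apply' (dirDeriv v) n φ]
    rw [integral_mul_dirDeriv hu (contDiff_iterate_dirDeriv hφ v n) hd, ih (contDiff_dirDeriv hu v),
      pow_succ]
    simp only [Function.iterate_succ_apply]
    ring

theorem hasWeakDeriv_partialDeriv {u : ℂ → ℂ} (hu : ContDiff ℝ ∞ u) (a b : ℕ) :
    HasWeakDeriv a b u (partialDeriv a b u) := by
  refine ⟨hu.continuous.locallyIntegrable.locallyIntegrableOn _,
    (contDiff_partialDeriv hu a b).continuous.locallyIntegrable.locallyIntegrableOn _, ?_⟩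
  intro φ hφ hc hs
  -- The test function and its derivatives are supported in the disk, so integrals may be taken over
  -- the plane, where integration by parts has no boundary terms.
  have hz : ∀ ψ : ℂ → ℂ, tsupport ψ ⊆ tsupport φ → ∀ g : ℂ → ℂ,
      ∫ z in disk, g z * ψ z = ∫ z, g z * ψ z := by
    intro ψ hψ g
    refine setIntegral_eq_integral_of_forall_compl_eq_zero fun z hz => ?_
    rw [image_eq_zero_of_notMem_tsupport fun h => hz (hs (hψ h)), mul_zero]
  have hb := tsupport_iterate_dirDeriv_subset Complex.I b φ
  have hbc : HasCompactSupport ((dirDeriv Complex.I)^[b] φ) :=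
    hc.of_isClosed_subset (isClosed_tsupport _) hb
  rw [hz (partialDeriv a b φ) ((tsupport_iterate_dirDeriv_subset _ _ _).trans hb), hz φ subset_rfl]
  unfold partialDeriv
  rw [integral_mul_iterate_dirDeriv hu (contDiff_iterate_dirDeriv hφ _ b) hbc,
    integral_mul_iterate_dirDeriv (contDiff_iterate_dirDeriv hu _ a) hφ hc,
    iterate_dirDeriv_comm hu, pow_add, mul_assoc]

theorem isOpen_disk : IsOpen disk := Metric.isOpen_ball

theorem integrableOn_disk_mul {g φ : ℂ → ℂ} (hg : LocallyIntegrableOn g disk)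
    (hφ : Continuous φ) (hc : HasCompactSupport φ) (hs : tsupport φ ⊆ disk) :
    IntegrableOn (fun z => g z * φ z) disk := by
  have h1 : IntegrableOn (fun z => g z * φ z) (tsupport φ) :=
    (hg.integrableOn_compact_subset hs hc).mul_continuousOn hφ.continuousOn hc
  refine (integrableOn_iff_integrable_of_support_subset ?_).1 h1 |>.integrableOn
  intro z hz
  by_contra h
  exact hz (by simp [image_eq_zero_of_notMem_tsupport h])

theorem HasWeakDeriv.ae_eq {a b : ℕ} {u g g' : ℂ → ℂ} (h : HasWeakDeriv a b u g)
    (h' : HasWeakDeriv a b u g') : g =ᵐ[volume.restrict disk] g' := by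
  have hz : ∀ᵐ z, z ∈ disk → (g - g') z = 0 := by
    refine isOpen_disk.ae_eq_zero_of_integral_contDiff_smul_eq_zero (h.2.1.sub h'.2.1) ?_
    intro φ hφ hc hs
    -- The fundamental lemma of the calculus of variations tests with real functions, the definition
    -- of weak derivatives with complex ones.
    set ψ : ℂ → ℂ := fun z => (φ z : ℂ)
    have hψ : ContDiff ℝ ∞ ψ := Complex.ofRealCLM.contDiff.comp hφ
    have hsupp : tsupport ψ ⊆ tsupport φ := closure_mono fun z hz => by
      simp only [ψ, Function.mem_support, ne_eq, Complex.ofReal_eq_zero] at hz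
      exact hz
    have hψc : HasCompactSupport ψ := hc.of_isClosed_subset (isClosed_tsupport _) hsupp
    have hψs : tsupport ψ ⊆ disk := hsupp.trans hs
    have e1 := h.2.2 ψ hψ hψc hψs
    have e2 := h'.2.2 ψ hψ hψc hψs
    have e3 : ∫ z in disk, g z * ψ z = ∫ z in disk, g' z * ψ z := by
      refine mul_left_cancel₀ (a := (-1 : ℂ) ^ (a + b)) (by simp) ?_
      rw [← e1, ← e2]
    have e4 : ∫ z, φ z • (g - g') z = ∫ z in disk, φ z • (g - g') z := by
      symm
      refine setIntegral_eq_integral_of_forall_compl_eq_zero fun z hz => ?_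
      rw [image_eq_zero_of_notMem_tsupport fun h => hz (hs h), zero_smul]
    rw [e4]
    calc _ = ∫ z in disk, (g z * ψ z - g' z * ψ z) := by
          refine integral_congr_ae (Eventually.of_forall fun z => ?_)
          simp only [Pi.sub_apply, Complex.real_smul, ψ]; ring
      _ = 0 := by
          rw [integral_sub (integrableOn_disk_mul h.2.1 hψ.continuous hψc hψs)
            (integrableOn_disk_mul h'.2.1 hψ.continuous hψc hψs), e3, sub_self]
  rw [EventuallyEq, ae_restrict_iff' measurableSet_disk]
  filter_upwards [hz] with z hz hzd
  simpa [sub_eq_zero] using hz hzd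

theorem HasWeakDeriv.congr {a b : ℕ} {u v g : ℂ → ℂ} (h : HasWeakDeriv a b u g)
    (huv : u =ᵐ[volume.restrict disk] v) : HasWeakDeriv a b v g := by
  refine ⟨?_, h.2.1, fun φ hφ hc hs => ?_⟩
  · rw [locallyIntegrableOn_iff isOpen_disk.isLocallyClosed]
    intro K hK hKc
    refine (h.1.integrableOn_compact_subset hK hKc).congr ?_
    exact ae_mono (Measure.restrict_mono hK le_rfl) huv
  · rw [← h.2.2 φ hφ hc hs]
    refine integral_congr_ae ?_
    filter_upwards [huv] with z hz
    rw [hz]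

/-- Needed because the projection is a choice, and the residual is identified only almost
everywhere. -/
theorem eDerivNorm_congr (α : ℝ) (a b : ℕ) {u v : ℂ → ℂ} (huv : u =ᵐ[wMeasure α] v) :
    eDerivNorm α a b u = eDerivNorm α a b v := by
  have h := (ae_wMeasure_iff α _).1 huv
  have : ∀ g, HasWeakDeriv a b u g ↔ HasWeakDeriv a b v g := fun g =>
    ⟨fun hg => hg.congr h, fun hg => hg.congr (EventuallyEq.symm h)⟩
  simp only [eDerivNorm, this]

theorem seminorm_congr (α : ℝ) (k : ℕ) {u v : ℂ → ℂ} (huv : u =ᵐ[wMeasure α] v) :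
    seminorm α k u = seminorm α k v := by
  simp only [seminorm, eSeminorm, eDerivNorm_congr α _ _ huv]

theorem sobolevNorm_congr (α : ℝ) (k : ℕ) {u v : ℂ → ℂ} (huv : u =ᵐ[wMeasure α] v) :
    sobolevNorm α k u = sobolevNorm α k v := by
  simp only [sobolevNorm, eSobolevNorm, eSeminorm, eDerivNorm_congr α _ _ huv]

/-- The classical derivative is a competitor in the infimum, and every other competitor agrees with
it almost everywhere. -/
theorem eDerivNorm_eq (α : ℝ) (a b : ℕ) {u : ℂ → ℂ} (hu : ContDiff ℝ ∞ u) :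
    eDerivNorm α a b u = eLpNorm (partialDeriv a b u) 2 (wMeasure α) := by
  refine le_antisymm (iInf₂_le _ (hasWeakDeriv_partialDeriv hu a b)) (le_iInf₂ fun g hg => ?_)
  exact (eLpNorm_congr_ae ((ae_wMeasure_iff α _).2
    ((hasWeakDeriv_partialDeriv hu a b).ae_eq hg))).le

/-! ### Sobolev norms of smooth functions as sums of integrals -/

/-- The square of the weighted `L²` norm, as an integral. -/
def normSq (α : ℝ) (f : ℂ → ℂ) : ℝ := ∫ z, ‖f z‖ ^ 2 ∂(wMeasure α)

theorem normSq_nonneg (α : ℝ) (f : ℂ → ℂ) : 0 ≤ normSq α f :=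
  integral_nonneg fun _ => by positivity

theorem eLpNorm_two_sq {α : ℝ} (hα : -1 < α) {f : ℂ → ℂ} (hf : Continuous f) :
    eLpNorm f 2 (wMeasure α) ^ 2 = ENNReal.ofReal (normSq α f) := by
  rw [(memLp_wMeasure hα hf 2).eLpNorm_eq_integral_rpow_norm two_ne_zero ENNReal.ofNat_ne_top,
    ← ENNReal.ofReal_pow (by positivity), normSq]
  congr 1
  simp only [ENNReal.toReal_ofNat, Real.rpow_two]
  have h0 : 0 ≤ ∫ z, ‖f z‖ ^ 2 ∂(wMeasure α) := normSq_nonneg α f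
  rw [← Real.rpow_natCast, ← Real.rpow_mul h0]
  norm_num

theorem eSeminorm_sq {α : ℝ} (hα : -1 < α) (k : ℕ) {u : ℂ → ℂ} (hu : ContDiff ℝ ∞ u) :
    eSeminorm α k u ^ 2 = ENNReal.ofReal (∑ p ∈ Finset.HasAntidiagonal.antidiagonal k,
      normSq α (partialDeriv p.1 p.2 u)) := by
  rw [eSeminorm, ← ENNReal.rpow_two, ← ENNReal.rpow_mul, one_div, inv_mul_cancel₀ two_ne_zero,
    ENNReal.rpow_one, ENNReal.ofReal_sum_of_nonneg fun _ _ => normSq_nonneg _ _]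
  refine Finset.sum_congr rfl fun p _ => ?_
  rw [eDerivNorm_eq α _ _ hu, eLpNorm_two_sq hα (contDiff_partialDeriv hu _ _).continuous]

theorem seminorm_sq {α : ℝ} (hα : -1 < α) (k : ℕ) {u : ℂ → ℂ} (hu : ContDiff ℝ ∞ u) :
    seminorm α k u ^ 2 = ∑ p ∈ Finset.HasAntidiagonal.antidiagonal k,
      normSq α (partialDeriv p.1 p.2 u) := by
  rw [seminorm, ← ENNReal.toReal_pow, eSeminorm_sq hα k hu,
    ENNReal.toReal_ofReal (Finset.sum_nonneg fun _ _ => normSq_nonneg _ _)]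

theorem seminorm_nonneg (α : ℝ) (k : ℕ) (u : ℂ → ℂ) : 0 ≤ seminorm α k u := ENNReal.toReal_nonneg

theorem sobolevNorm_nonneg (α : ℝ) (k : ℕ) (u : ℂ → ℂ) : 0 ≤ sobolevNorm α k u :=
  ENNReal.toReal_nonneg

theorem eSobolevNorm_sq {α : ℝ} (hα : -1 < α) (m : ℕ) {u : ℂ → ℂ} (hu : ContDiff ℝ ∞ u) :
    eSobolevNorm α m u ^ 2
      = ENNReal.ofReal (∑ k ∈ Finset.range (m + 1), seminorm α k u ^ 2) := by
  rw [eSobolevNorm, ← ENNReal.rpow_two, ← ENNReal.rpow_mul, one_div, inv_mul_cancel₀ two_ne_zero,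
    ENNReal.rpow_one, ENNReal.ofReal_sum_of_nonneg fun _ _ => by positivity]
  refine Finset.sum_congr rfl fun p _ => ?_
  rw [eSeminorm_sq hα p hu, seminorm_sq hα p hu]

theorem sobolevNorm_sq {α : ℝ} (hα : -1 < α) (m : ℕ) {u : ℂ → ℂ} (hu : ContDiff ℝ ∞ u) :
    sobolevNorm α m u ^ 2 = ∑ k ∈ Finset.range (m + 1), seminorm α k u ^ 2 := by
  rw [sobolevNorm, ← ENNReal.toReal_pow, eSobolevNorm_sq hα m hu,
    ENNReal.toReal_ofReal (Finset.sum_nonneg fun _ _ => by positivity)]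

theorem memSobolev_of_contDiff {α : ℝ} (hα : -1 < α) (m : ℕ) {u : ℂ → ℂ} (hu : ContDiff ℝ ∞ u) :
    MemSobolev α m u := by
  refine ⟨memLp_wMeasure hα hu.continuous 2, lt_top_iff_ne_top.2 fun h => ?_⟩
  have := eSobolevNorm_sq hα m hu
  rw [h] at this
  simp at this

theorem l2Norm_sq {α : ℝ} (hα : -1 < α) {u : ℂ → ℂ} (hu : Continuous u) :
    l2Norm α u ^ 2 = normSq α u := by
  rw [l2Norm, ← ENNReal.toReal_pow, eLpNorm_two_sq hα hu, ENNReal.toReal_ofReal (normSq_nonneg _ _)]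

/-! ### Wirtinger derivatives of radial Jacobi polynomials -/

/-- The function `z ^ i * conj z ^ j * Q (1 - |z|²)`. -/
def angRadial (i j : ℕ) (Q : ℝ[X]) (z : ℂ) : ℂ := z ^ i * (starRingEnd ℂ) z ^ j * radial Q z

theorem contDiff_radial (Q : ℝ[X]) : ContDiff ℝ ∞ (radial Q) := by
  have h1 : ContDiff ℝ ∞ fun z : ℂ => 1 - ‖z‖ ^ 2 := contDiff_const.sub (contDiff_norm_sq ℝ)
  have h2 : ContDiff ℝ ∞ fun x : ℝ => Q.eval x := by
    simpa only [coe_aeval_eq_eval] using Q.contDiff_aeval (𝕜 := ℝ) ∞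
  exact Complex.ofRealCLM.contDiff.comp (h2.comp h1)

theorem contDiff_angRadial (i j : ℕ) (Q : ℝ[X]) : ContDiff ℝ ∞ (angRadial i j Q) := by
  have h1 : ContDiff ℝ ∞ fun z : ℂ => (starRingEnd ℂ) z := Complex.conjCLE.contDiff
  exact ((contDiff_id.pow i).mul (h1.pow j)).mul (contDiff_radial Q)

theorem radial_eq_eval_map (Q : ℝ[X]) (z : ℂ) :
    radial Q z = (Q.map (algebraMap ℝ ℂ)).eval (1 - z * (starRingEnd ℂ) z) := by
  have : (1 - z * (starRingEnd ℂ) z) = ((1 - ‖z‖ ^ 2 : ℝ) : ℂ) := by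
    rw [Complex.mul_conj, Complex.normSq_eq_norm_sq]; push_cast; rfl
  rw [this, radial, eval_map]
  exact (eval₂_at_apply (algebraMap ℝ ℂ) _).symm

theorem radial_one_sub_X (z : ℂ) : radial (1 - X) z = z * (starRingEnd ℂ) z := by
  rw [radial_eq_eval_map]; simp

theorem angRadial_C_mul (i j : ℕ) (c : ℝ) (Q : ℝ[X]) (z : ℂ) :
    angRadial i j (C c * Q) z = c * angRadial i j Q z := by
  simp [angRadial, radial]; ring

theorem angRadial_sub (i j : ℕ) (P Q : ℝ[X]) (z : ℂ) :
    angRadial i j (P - Q) z = angRadial i j P z - angRadial i j Q z := by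
  simp [angRadial, radial]; ring

theorem angRadial_one_sub_X_mul (i j : ℕ) (Q : ℝ[X]) (z : ℂ) :
    angRadial i j ((1 - X) * Q) z = angRadial (i + 1) (j + 1) Q z := by
  have h := congrFun (radial_mul (1 - X) Q) z
  rw [angRadial, angRadial, h, radial_one_sub_X]; ring

/-- The derivative in direction v is v ∂ + conj v ∂bar, and the two brackets are the Wirtinger
derivatives, found by writing |z|² = z conj z and differentiating along t ↦ z + t v. The truncated
`i - 1` and `j - 1` are harmless, since at zero the factor in front vanishes. -/
theorem dirDeriv_angRadial (i j : ℕ) (Q : ℝ[X]) (v z : ℂ) :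
    dirDeriv v (angRadial i j Q) z
      = v * (i * angRadial (i - 1) j Q z - angRadial i (j + 1) (derivative Q) z)
        + (starRingEnd ℂ) v *
          (j * angRadial i (j - 1) Q z - angRadial (i + 1) j (derivative Q) z) := by
  have hdiff : DifferentiableAt ℝ (angRadial i j Q) z :=
    (contDiff_angRadial i j Q).differentiable (by simp) z
  rw [dirDeriv, ← hdiff.lineDeriv_eq_fderiv]
  set Qc := Q.map (algebraMap ℝ ℂ) with hQc
  set w := (starRingEnd ℂ) z with hw
  set v' := (starRingEnd ℂ) v with hv
  have h1 : HasDerivAt (fun t : ℝ => z + t * v) v 0 := by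
    have := ((hasDerivAt_id (0 : ℝ)).ofReal_comp.mul_const v).const_add z
    simpa using this
  have h2 : HasDerivAt (fun t : ℝ => w + t * v') v' 0 := by
    have := ((hasDerivAt_id (0 : ℝ)).ofReal_comp.mul_const v').const_add w
    simpa using this
  have h3 := (h1.mul h2).const_sub 1
  have h4 := (Qc.hasDerivAt (1 - (z + ((0 : ℝ) : ℂ) * v) * (w + ((0 : ℝ) : ℂ) * v'))).comp
    (0 : ℝ) h3
  have h5 := ((h1.pow i).mul (h2.pow j)).mul h4
  have e : (fun t : ℝ => angRadial i j Q (z + t • v))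
      = (fun t : ℝ => z + t * v) ^ i * (fun t : ℝ => w + t * v') ^ j *
        ((fun x => Qc.eval x) ∘ fun t : ℝ => 1 - (z + t * v) * (w + t * v')) := by
    funext t
    simp only [angRadial, radial_eq_eval_map, Pi.mul_apply, Pi.pow_apply, Function.comp,
      Complex.real_smul, map_add, map_mul, Complex.conj_ofReal, hw, hv, hQc]
  rw [lineDeriv, e]
  refine h5.deriv.trans ?_
  have hd : (derivative Q).map (algebraMap ℝ ℂ) = derivative Qc := by rw [hQc, derivative_map]
  simp only [angRadial, radial_eq_eval_map, hd, ← hQc, ← hw, Pi.pow_apply, Pi.mul_apply,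
    Function.comp, Complex.ofReal_zero, zero_mul, add_zero]
  ring

theorem hasFreq_angRadial (i j : ℕ) (Q : ℝ[X]) : HasFreq ((i : ℤ) - j) (angRadial i j Q) := by
  intro η z
  have hn : ‖(η : ℂ) * z‖ = ‖z‖ := by rw [norm_mul, Circle.norm_coe, one_mul]
  have h0 : (η : ℂ) ≠ 0 := Circle.coe_ne_zero η
  rw [angRadial, angRadial, radial, radial, hn, map_mul, ← Circle.coe_inv_eq_conj, Circle.coe_inv,
    zpow_sub₀ h0, mul_pow, mul_pow, zpow_natCast, zpow_natCast, inv_pow]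
  ring

theorem HasFreq.const_mul {m : ℤ} {f : ℂ → ℂ} (hf : HasFreq m f) (c : ℂ) :
    HasFreq m fun z => c * f z := by
  intro η z
  simp only [hf η z]; ring

theorem normSq_angRadial {α : ℝ} (hα : -1 < α) (i j : ℕ) (Q : ℝ[X]) :
    normSq α (angRadial i j Q) = Real.pi * wInt α ((1 - X) ^ (i + j) * (Q * Q)) := by
  have h := integral_radial hα ((1 - X) ^ (i + j) * (Q * Q))
  have e : ∀ z, radial ((1 - X) ^ (i + j) * (Q * Q)) z = ((‖angRadial i j Q z‖ ^ 2 : ℝ) : ℂ) := by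
    intro z
    rw [angRadial, radial]
    simp only [norm_mul, norm_pow, RCLike.norm_conj, radial, Complex.norm_real, Real.norm_eq_abs,
      mul_pow, sq_abs, eval_mul, eval_pow, eval_sub, eval_one, eval_X]
    push_cast
    ring
  simp only [e] at h
  rw [integral_complex_ofReal] at h
  exact_mod_cast h

/-- The Wirtinger derivative `∂ ^ p ∂bar ^ q` of `radial (jac n a 0)`. -/
def wirt (n : ℕ) (a : ℝ) (p q : ℕ) (z : ℂ) : ℂ :=
  ((poch (n + a + 1) (max p q) * n.descFactorial (min p q) : ℝ) : ℂ) *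
    angRadial (q - p) (p - q) (jac (n - max p q) (a + p + q) ((q - p + (p - q) : ℕ) : ℝ)) z

theorem contDiff_wirt (n : ℕ) (a : ℝ) (p q : ℕ) : ContDiff ℝ ∞ (wirt n a p q) :=
  contDiff_const.mul (contDiff_angRadial _ _ _)

theorem wirt_conj (n : ℕ) (a : ℝ) (p q : ℕ) (z : ℂ) :
    wirt n a q p z = (starRingEnd ℂ) (wirt n a p q z) := by
  simp only [wirt, angRadial, radial, map_mul, map_pow, Complex.conj_conj, Complex.conj_ofReal]
  rw [max_comm, min_comm, add_right_comm, add_comm (p - q) (q - p)]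
  ring_nf

theorem dirDeriv_conj {f : ℂ → ℂ} (hf : ContDiff ℝ ∞ f) (v z : ℂ) :
    dirDeriv v (fun z => (starRingEnd ℂ) (f z)) z = (starRingEnd ℂ) (dirDeriv v f z) := by
  have h := (hf.differentiable (by simp) z).hasFDerivAt
  have h2 := (Complex.conjCLE.toContinuousLinearMap.hasFDerivAt (x := f z)).comp z h
  change fderiv ℝ (Complex.conjCLE ∘ f) z v = _
  exact congrArg (fun L => L v) h2.fderiv

/-- This confirms the closed formula `wirt`. For p < q the function is z^(q-p) times a polynomial in
x: ∂ removes a power of z through `jac_lower`, and ∂bar adds one through `derivative_jac`, whose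
minus sign cancels that of x = 1 - |z|². For p = q both derivatives go through `derivative_jac`. -/
theorem dirDeriv_wirt_of_le (n : ℕ) (a : ℝ) (p q : ℕ) (hpq : p ≤ q) (h : p + q < n) (v z : ℂ) :
    dirDeriv v (wirt n a p q) z
      = v * wirt n a (p + 1) q z + (starRingEnd ℂ) v * wirt n a p (q + 1) z := by
  have hcm : dirDeriv v (wirt n a p q) z
      = ((poch (n + a + 1) (max p q) * n.descFactorial (min p q) : ℝ) : ℂ) * dirDeriv v
        (angRadial (q - p) (p - q) (jac (n - max p q) (a + p + q) ((q - p + (p - q) : ℕ) : ℝ))) z := by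
    have hd := ((contDiff_angRadial (q - p) (p - q) (jac (n - max p q) (a + p + q)
      ((q - p + (p - q) : ℕ) : ℝ))).differentiable (by simp)) z
    simp only [dirDeriv]
    have := (hd.hasFDerivAt.const_mul
      ((poch (n + a + 1) (max p q) * n.descFactorial (min p q) : ℝ) : ℂ)).fderiv
    change fderiv ℝ (fun z => _ * angRadial _ _ _ z) z v = _
    rw [this]; rfl
  rw [hcm, dirDeriv_angRadial]
  obtain ⟨m, hm⟩ : ∃ m, n = q + m + 1 := ⟨n - q - 1, by omega⟩
  have hn : (n : ℝ) = q + m + 1 := by rw [hm]; push_cast; ring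
  rcases Nat.lt_or_eq_of_le hpq with hlt | rfl
  · obtain ⟨e, rfl⟩ := Nat.exists_eq_add_of_lt hlt
    have d1 := derivative_jac m (a + p + (p + e + 1 : ℕ)) ((e + 1 : ℕ) : ℝ)
    have d2 := jac_lower (m + 1) (a + p + (p + e + 1 : ℕ)) ((e + 1 : ℕ) : ℝ)
    simp only [wirt]
    rw [show max p (p + e + 1) = p + e + 1 by omega, show min p (p + e + 1) = p by omega,
      show max (p + 1) (p + e + 1) = p + e + 1 by omega,
      show min (p + 1) (p + e + 1) = p + 1 by omega,
      show max p (p + e + 1 + 1) = p + e + 1 + 1 by omega,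
      show min p (p + e + 1 + 1) = p by omega,
      show p + e + 1 - p = e + 1 by omega, show p - (p + e + 1) = 0 by omega,
      show p + e + 1 - (p + 1) = e by omega, show p + 1 - (p + e + 1) = 0 by omega,
      show p + e + 1 + 1 - p = e + 1 + 1 by omega, show p - (p + e + 1 + 1) = 0 by omega,
      show n - (p + e + 1) = m + 1 by omega, show n - (p + e + 1 + 1) = m by omega]
    simp only [add_zero]
    set J := jac (m + 1) (a + p + (p + e + 1 : ℕ)) ((e + 1 : ℕ) : ℝ) with hJ
    have s1 : a + ((p + 1 : ℕ) : ℝ) + ((p + e + 1 : ℕ) : ℝ) = a + p + (p + e + 1 : ℕ) + 1 := by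
      push_cast; ring
    have s2 : ((e + 1 : ℕ) : ℝ) - 1 = (e : ℝ) := by push_cast; ring
    have s3 : a + (p : ℝ) + ((p + e + 1 + 1 : ℕ) : ℝ) = a + p + (p + e + 1 : ℕ) + 1 := by
      push_cast; ring
    rw [s2] at d2
    have g1 : ((e + 1 : ℕ) : ℂ) * angRadial (e + 1 - 1) 0 J z
        - angRadial (e + 1) (0 + 1) (derivative J) z
        = ((((m + 1 : ℕ) : ℝ) + ((e + 1 : ℕ) : ℝ) : ℝ) : ℂ) *
          angRadial e 0 (jac (m + 1) (a + p + (p + e + 1 : ℕ) + 1) e) z := by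
      rw [← angRadial_C_mul, ← d2, angRadial_sub, angRadial_C_mul, angRadial_one_sub_X_mul,
        Nat.add_sub_cancel]
      push_cast; rfl
    have g2 : angRadial (e + 1 + 1) 0 (derivative J) z
        = ((-((m : ℝ) + (a + p + (p + e + 1 : ℕ)) + ((e + 1 : ℕ) : ℝ) + 2) : ℝ) : ℂ) *
          angRadial (e + 1 + 1) 0 (jac m (a + p + (p + e + 1 : ℕ) + 1) ((e + 1 + 1 : ℕ) : ℝ)) z := by
      rw [d1, angRadial_C_mul]; push_cast; rfl
    rw [g1, g2, s1, s3, poch_succ _ (p + e + 1), Nat.descFactorial_succ]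
    push_cast [Nat.cast_sub (show p ≤ n by omega)]
    have hnc : (n : ℂ) = p + e + 1 + m + 1 := by rw [hm]; push_cast; ring
    rw [hnc]
    ring
  · have d1 := derivative_jac m (a + p + p) ((0 : ℕ) : ℝ)
    simp only [wirt]
    rw [show max p p = p by omega, show min p p = p by omega,
      show max (p + 1) p = p + 1 by omega, show min (p + 1) p = p by omega,
      show max p (p + 1) = p + 1 by omega, show min p (p + 1) = p by omega,
      show p + 1 - p = 1 by omega, show p - (p + 1) = 0 by omega, show p - p = 0 by omega,
      show n - p = m + 1 by omega, show n - (p + 1) = m by omega]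
    simp only [add_zero, zero_add]
    set J := jac (m + 1) (a + p + p) ((0 : ℕ) : ℝ) with hJ
    have s1 : a + ((p + 1 : ℕ) : ℝ) + p = a + p + p + 1 := by push_cast; ring
    have s3 : a + (p : ℝ) + ((p + 1 : ℕ) : ℝ) = a + p + p + 1 := by push_cast; ring
    have s4 : ((0 : ℕ) : ℝ) + 1 = ((1 : ℕ) : ℝ) := by norm_num
    rw [s4] at d1
    rw [d1, angRadial_C_mul, angRadial_C_mul, s1, s3, poch_succ]
    have hnc : (n : ℂ) = p + m + 1 := by rw [hm]; push_cast; ring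
    push_cast
    rw [hnc]
    ring

theorem dirDeriv_wirt (n : ℕ) (a : ℝ) (p q : ℕ) (h : p + q < n) (v z : ℂ) :
    dirDeriv v (wirt n a p q) z
      = v * wirt n a (p + 1) q z + (starRingEnd ℂ) v * wirt n a p (q + 1) z := by
  rcases le_total p q with hpq | hpq
  · exact dirDeriv_wirt_of_le n a p q hpq h v z
  · have e : wirt n a p q = fun z => (starRingEnd ℂ) (wirt n a q p z) := by
      funext z; exact wirt_conj n a q p z
    rw [e, dirDeriv_conj (contDiff_wirt n a q p), dirDeriv_wirt_of_le n a q p hpq (by omega),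
      wirt_conj n a q (p + 1), wirt_conj n a (q + 1) p]
    simp only [map_add, map_mul, Complex.conj_conj]
    ring

theorem wirt_zero_zero (n : ℕ) (a : ℝ) : wirt n a 0 0 = radial (jac n a 0) := by
  funext z
  simp [wirt, angRadial, poch_zero]

/-! ### Seminorms as weighted sums of norms of Wirtinger derivatives -/

/-- The combination of Wirtinger derivatives of order `m` with the coefficients of `K`. -/
def wirtComb (n : ℕ) (a : ℝ) (m : ℕ) (K : ℂ[X]) (z : ℂ) : ℂ :=
  ∑ p ∈ Finset.range (m + 1), K.coeff p * wirt n a p (m - p) z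

/-- X^p stands for ∂^p ∂bar^(m-p), so a directional derivative acts by multiplication with v X +
conj v while the order m grows by one. For v = 1 and v = I these are the two factors of `symb`. -/
theorem dirDeriv_wirtComb (n : ℕ) (a : ℝ) (m : ℕ) (K : ℂ[X]) (hK : K.natDegree ≤ m) (hm : m < n)
    (v : ℂ) :
    dirDeriv v (wirtComb n a m K)
      = wirtComb n a (m + 1) ((C v * X + C ((starRingEnd ℂ) v)) * K) := by
  funext z
  have h1 : dirDeriv v (wirtComb n a m K) z
      = ∑ p ∈ Finset.range (m + 1), K.coeff p * dirDeriv v (wirt n a p (m - p)) z := by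
    have : HasFDerivAt (wirtComb n a m K)
        (∑ p ∈ Finset.range (m + 1), K.coeff p • fderiv ℝ (wirt n a p (m - p)) z) z := by
      refine HasFDerivAt.fun_sum fun p _ => ?_
      exact (((contDiff_wirt n a p (m - p)).differentiable (by simp)) z).hasFDerivAt.const_mul _
    simp only [dirDeriv, this.fderiv, sum_apply]
    rfl
  have hlast : K.coeff (m + 1) = 0 := coeff_eq_zero_of_natDegree_lt (by omega)
  have h2 : ∀ p ∈ Finset.range (m + 1), K.coeff p * dirDeriv v (wirt n a p (m - p)) z
      = v * K.coeff p * wirt n a (p + 1) (m - p) z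
        + (starRingEnd ℂ) v * K.coeff p * wirt n a p (m + 1 - p) z := by
    intro p hp
    have : p ≤ m := by simp at hp; omega
    rw [dirDeriv_wirt _ _ _ _ (by omega), show m - p + 1 = m + 1 - p by omega]
    ring
  rw [h1, Finset.sum_congr rfl h2, Finset.sum_add_distrib, wirtComb]
  have h3 : ∀ p, ((C v * X + C ((starRingEnd ℂ) v)) * K).coeff p * wirt n a p (m + 1 - p) z
      = v * (X * K).coeff p * wirt n a p (m + 1 - p) z
        + (starRingEnd ℂ) v * K.coeff p * wirt n a p (m + 1 - p) z := by
    intro p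
    rw [add_mul, coeff_add, mul_assoc, coeff_C_mul, coeff_C_mul]; ring
  rw [Finset.sum_congr rfl fun p _ => h3 p, Finset.sum_add_distrib]
  congr 1
  · rw [Finset.sum_range_succ' _ (m + 1)]
    simp
  · rw [Finset.sum_range_succ _ (m + 1), hlast]
    simp

/-- The symbol of `∂₁ ^ a ∂₂ ^ b` in terms of Wirtinger derivatives. -/
def symb (a b : ℕ) : ℂ[X] := (X + 1) ^ a * (C Complex.I * (X - 1)) ^ b

theorem natDegree_symb_le (a b : ℕ) : (symb a b).natDegree ≤ a + b := by
  unfold symb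
  compute_degree

theorem partialDeriv_radial_jac (n : ℕ) (a : ℝ) (s t : ℕ) (h : s + t ≤ n) :
    partialDeriv s t (radial (jac n a 0)) = wirtComb n a (s + t) (symb s t) := by
  induction s with
  | zero =>
    induction t with
    | zero =>
      funext z
      simp [partialDeriv, wirtComb, symb, wirt_zero_zero]
    | succ t ih =>
      have := ih (by omega)
      simp only [partialDeriv, Function.iterate_zero, id_eq, zero_add] at this ⊢
      rw [Function.iterate_succ_apply', this, dirDeriv_wirtComb _ _ _ _
        (by simpa using natDegree_symb_le 0 t) (by omega)]
      congr 1
      simp only [symb, Complex.conj_I, C_neg, pow_succ]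
      ring
  | succ s ih =>
    have := ih (by omega)
    rw [show s + 1 + t = s + t + 1 by omega]
    simp only [partialDeriv] at this ⊢
    rw [Function.iterate_succ_apply', this, dirDeriv_wirtComb _ _ _ _ (natDegree_symb_le s t)
      (by omega)]
    congr 1
    simp only [symb, map_one, pow_succ]
    ring

theorem hasFreq_wirt (n : ℕ) (a : ℝ) (p q : ℕ) : HasFreq ((q : ℤ) - p) (wirt n a p q) := by
  have := (hasFreq_angRadial (q - p) (p - q)
    (jac (n - max p q) (a + p + q) ((q - p + (p - q) : ℕ) : ℝ))).const_mul
    ((poch (n + a + 1) (max p q) * n.descFactorial (min p q) : ℝ) : ℂ)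
  have e : (((q - p : ℕ) : ℤ) - ((p - q : ℕ) : ℤ)) = (q : ℤ) - p := by omega
  rw [e] at this
  exact this

theorem normSq_sum_of_freq {α : ℝ} (hα : -1 < α) (s : Finset ℕ) (f : ℕ → ℂ → ℂ) (c : ℕ → ℂ)
    (m : ℕ → ℤ) (hf : ∀ p ∈ s, HasFreq (m p) (f p)) (hm : Set.InjOn m s)
    (hc : ∀ p ∈ s, Continuous (f p)) :
    normSq α (fun z => ∑ p ∈ s, c p * f p z) = ∑ p ∈ s, ‖c p‖ ^ 2 * normSq α (f p) := by
  have key : ∀ g : ℂ → ℂ, ((normSq α g : ℝ) : ℂ) = ∫ z, g z * (starRingEnd ℂ) (g z) ∂(wMeasure α) := by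
    intro g
    rw [normSq, ← integral_complex_ofReal]
    refine integral_congr_ae (Eventually.of_forall fun z => ?_)
    simp only [Complex.mul_conj, Complex.normSq_eq_norm_sq]
  have hi : ∀ p ∈ s, ∀ q ∈ s, Integrable
      (fun z => c p * (starRingEnd ℂ) (c q) * (f p z * (starRingEnd ℂ) (f q z))) (wMeasure α) := by
    intro p hp q hq
    exact integrable_wMeasure hα
      (continuous_const.mul ((hc p hp).mul (Complex.continuous_conj.comp (hc q hq))))
  have : ((normSq α (fun z => ∑ p ∈ s, c p * f p z) : ℝ) : ℂ)
      = ((∑ p ∈ s, ‖c p‖ ^ 2 * normSq α (f p) : ℝ) : ℂ) := by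
    rw [key]
    have e : ∀ z, (∑ p ∈ s, c p * f p z) * (starRingEnd ℂ) (∑ p ∈ s, c p * f p z)
        = ∑ p ∈ s, ∑ q ∈ s, c p * (starRingEnd ℂ) (c q) * (f p z * (starRingEnd ℂ) (f q z)) := by
      intro z
      rw [map_sum, Finset.sum_mul_sum]
      refine Finset.sum_congr rfl fun p _ => Finset.sum_congr rfl fun q _ => ?_
      rw [map_mul]; ring
    simp only [e]
    rw [integral_finsetSum _ fun p hp => integrable_finsetSum _ fun q hq => hi p hp q hq]
    push_cast
    refine Finset.sum_congr rfl fun p hp => ?_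
    rw [integral_finsetSum _ fun q hq => hi p hp q hq, Finset.sum_eq_single p]
    · rw [integral_const_mul, ← key, Complex.mul_conj, Complex.normSq_eq_norm_sq]
      push_cast; rfl
    · intro q hq hqp
      rw [integral_const_mul, integral_mul_conj_eq_zero_of_freq α _ (hf p hp) (hf q hq), mul_zero]
      exact fun h => hqp (hm hp hq h).symm
    · exact fun h => absurd hp h
  exact_mod_cast this

theorem normSq_const_mul (α : ℝ) (c : ℂ) (f : ℂ → ℂ) :
    normSq α (fun z => c * f z) = ‖c‖ ^ 2 * normSq α f := by
  simp only [normSq, norm_mul, mul_pow, integral_const_mul]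

/-- The sum over `s + t = k` of the squared coefficients at `X ^ p` of the symbols. -/
def symbWeight (k p : ℕ) : ℝ :=
  ∑ x ∈ Finset.HasAntidiagonal.antidiagonal k, ‖(symb x.1 x.2).coeff p‖ ^ 2

/-- The squared weighted `L²` norm of `wirt n a p q`. -/
def wirtSq (α : ℝ) (n : ℕ) (a : ℝ) (p q : ℕ) : ℝ :=
  (poch (n + a + 1) (max p q) * n.descFactorial (min p q)) ^ 2 * (Real.pi *
    wInt α ((1 - X) ^ (q - p + (p - q)) *
      (jac (n - max p q) (a + p + q) ((q - p + (p - q) : ℕ) : ℝ) *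
        jac (n - max p q) (a + p + q) ((q - p + (p - q) : ℕ) : ℝ))))

theorem normSq_wirt {α : ℝ} (hα : -1 < α) (n : ℕ) (a : ℝ) (p q : ℕ) :
    normSq α (wirt n a p q) = wirtSq α n a p q := by
  have := normSq_const_mul α ((poch (n + a + 1) (max p q) * n.descFactorial (min p q) : ℝ) : ℂ)
    (angRadial (q - p) (p - q) (jac (n - max p q) (a + p + q) ((q - p + (p - q) : ℕ) : ℝ)))
  rw [normSq_angRadial hα, Complex.norm_real, Real.norm_eq_abs, sq_abs] at this
  exact this

/-- The derivative ∂^p ∂bar^(k-p) has frequency k - 2p, so distinct p are orthogonal and all cross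
terms vanish. The remaining weights `symbWeight` depend neither on n nor on the parameters. -/
theorem seminorm_sq_radial_jac {α : ℝ} (hα : -1 < α) (n : ℕ) (a : ℝ) (k : ℕ) (hk : k ≤ n) :
    seminorm α k (radial (jac n a 0)) ^ 2
      = ∑ p ∈ Finset.range (k + 1), symbWeight k p * wirtSq α n a p (k - p) := by
  rw [seminorm_sq hα k (contDiff_radial _)]
  have h1 : ∀ x ∈ Finset.HasAntidiagonal.antidiagonal k,
      normSq α (partialDeriv x.1 x.2 (radial (jac n a 0)))
        = ∑ p ∈ Finset.range (k + 1), ‖(symb x.1 x.2).coeff p‖ ^ 2 * wirtSq α n a p (k - p) := by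
    intro x hx
    have hx' : x.1 + x.2 = k := by simpa using hx
    rw [partialDeriv_radial_jac n a x.1 x.2 (by omega), hx']
    simp only [← normSq_wirt hα]
    refine normSq_sum_of_freq hα _ (fun p => wirt n a p (k - p)) _
      (fun p => ((k - p : ℕ) : ℤ) - p) (fun p _ => hasFreq_wirt _ _ _ _) ?_
      (fun p _ => (contDiff_wirt _ _ _ _).continuous)
    intro p hp q hq h
    simp at hp hq h
    omega
  rw [Finset.sum_congr rfl h1, Finset.sum_comm]
  refine Finset.sum_congr rfl fun p _ => ?_
  rw [symbWeight, Finset.sum_mul]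

theorem dirDeriv_const_mul {f : ℂ → ℂ} (hf : ContDiff ℝ ∞ f) (c v : ℂ) :
    dirDeriv v (fun z => c * f z) = fun z => c * dirDeriv v f z := by
  funext z
  have := ((hf.differentiable (by simp) z).hasFDerivAt.const_mul c).fderiv
  simp only [dirDeriv, this]
  rfl

theorem partialDeriv_const_mul {f : ℂ → ℂ} (hf : ContDiff ℝ ∞ f) (c : ℂ) (a b : ℕ) :
    partialDeriv a b (fun z => c * f z) = fun z => c * partialDeriv a b f z := by
  have h : ∀ (n : ℕ) (v : ℂ) (f : ℂ → ℂ), ContDiff ℝ ∞ f →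
      (dirDeriv v)^[n] (fun z => c * f z) = fun z => c * (dirDeriv v)^[n] f z := by
    intro n v f hf
    induction n with
    | zero => rfl
    | succ n ih =>
      rw [Function.iterate_succ_apply', ih, dirDeriv_const_mul (contDiff_iterate_dirDeriv hf v n)]
      simp only [Function.iterate_succ_apply']
  rw [partialDeriv, h _ _ f hf, h _ _ _ (contDiff_iterate_dirDeriv hf _ _)]
  rfl

theorem seminorm_sq_const_mul {α : ℝ} (hα : -1 < α) {f : ℂ → ℂ} (hf : ContDiff ℝ ∞ f) (c : ℝ)
    (k : ℕ) : seminorm α k (fun z => (c : ℂ) * f z) ^ 2 = c ^ 2 * seminorm α k f ^ 2 := by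
  rw [seminorm_sq hα k (contDiff_const.mul hf), seminorm_sq hα k hf, Finset.mul_sum]
  refine Finset.sum_congr rfl fun p _ => ?_
  rw [partialDeriv_const_mul hf, normSq_const_mul, Complex.norm_real, Real.norm_eq_abs, sq_abs]

/-! ### Orthogonal projection and the residual -/

theorem polyFun_mem_polySpace {N : ℕ} {p : MvPolynomial (Fin 2) ℂ} (hp : p.totalDegree ≤ N) :
    polyFun p ∈ polySpace N :=
  Submodule.mem_map_of_mem ((MvPolynomial.mem_restrictTotalDegree _ _ _).2 hp)

theorem continuous_of_mem_polySpace {N : ℕ} {f : ℂ → ℂ} (hf : f ∈ polySpace N) : Continuous f := by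
  obtain ⟨p, -, rfl⟩ := hf
  refine (MvPolynomial.continuous_eval p).comp ?_
  refine continuous_pi fun i => ?_
  fin_cases i
  · exact Complex.continuous_ofReal.comp Complex.continuous_re
  · exact Complex.continuous_ofReal.comp Complex.continuous_im

theorem radial_mem_polySpace {N : ℕ} {Q : ℝ[X]} (hQ : 2 * Q.natDegree ≤ N) :
    radial Q ∈ polySpace N := by
  set w : MvPolynomial (Fin 2) ℂ := 1 - MvPolynomial.X 0 ^ 2 - MvPolynomial.X 1 ^ 2 with hw
  have hdeg : w.totalDegree ≤ 2 := by
    refine (MvPolynomial.totalDegree_sub _ _).trans (max_le ?_ (by simp))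
    refine (MvPolynomial.totalDegree_sub _ _).trans (max_le (by simp) (by simp))
  have e : radial Q = ∑ k ∈ Finset.range (Q.natDegree + 1), (Q.coeff k : ℂ) • polyFun (w ^ k) := by
    funext z
    have hz : (1 : ℂ) - (z.re : ℂ) ^ 2 - (z.im : ℂ) ^ 2 = ((1 - ‖z‖ ^ 2 : ℝ) : ℂ) := by
      rw [← Complex.normSq_eq_norm_sq, Complex.normSq_apply]; push_cast; ring
    rw [radial, eval_eq_sum_range, Finset.sum_apply]
    push_cast
    refine Finset.sum_congr rfl fun k _ => ?_
    simp only [Pi.smul_apply, smul_eq_mul, polyFun, LinearMap.coe_mk, AddHom.coe_mk, hw, map_pow,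
      map_sub, map_one, MvPolynomial.eval_X, Matrix.cons_val_zero, Matrix.cons_val_one, hz]
    push_cast; rfl
  rw [e]
  refine Submodule.sum_mem _ fun k hk => Submodule.smul_mem _ _ (polyFun_mem_polySpace ?_)
  have hk' : k ≤ Q.natDegree := by simp at hk; omega
  calc _ ≤ k * w.totalDegree := MvPolynomial.totalDegree_pow _ _
    _ ≤ k * 2 := by gcongr
    _ ≤ N := by omega

/-- For i ≠ j the frequencies differ. For i = j the second factor is (1-x)^i with i < n, and
orthogonality in x applies. -/
theorem integral_radial_jac_mul_conj {α : ℝ} (hα : -1 < α) (n i j : ℕ) (h : i + j < 2 * n) :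
    ∫ z, radial (jac n α 0) z * (starRingEnd ℂ) (z ^ i * (starRingEnd ℂ) z ^ j) ∂(wMeasure α)
      = 0 := by
  rcases eq_or_ne i j with rfl | hij
  · have e : ∀ z, radial (jac n α 0) z * (starRingEnd ℂ) (z ^ i * (starRingEnd ℂ) z ^ i)
        = radial (jac n α 0 * (1 - X) ^ i) z := by
      intro z
      have h1 : z ^ i * (starRingEnd ℂ) z ^ i = (((‖z‖ ^ 2) ^ i : ℝ) : ℂ) := by
        rw [← mul_pow, Complex.mul_conj, Complex.normSq_eq_norm_sq]; push_cast; rfl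
      rw [h1, Complex.conj_ofReal]
      simp [radial]
    simp only [e]
    have hz := wInt_jac_mul_eq_zero hα n 0 ((1 - X) ^ i) (by
      have : ((1 - X : ℝ[X]) ^ i).natDegree ≤ i := by compute_degree
      omega)
    simp only [pow_zero, one_mul, Nat.cast_zero] at hz
    rw [integral_radial hα, hz]
    simp
  · have h1 := hasFreq_angRadial 0 0 (jac n α 0)
    have h2 := hasFreq_angRadial i j 1
    have := integral_mul_conj_eq_zero_of_freq α (by omega) h1 h2
    simpa [angRadial, radial] using this

/-- Mixing powers of re z, im z with powers of z, conj z makes the induction possible: each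
coordinate is replaced by a combination of z and conj z, which preserves the total degree. -/
theorem integral_radial_jac_mul_conj_monomial {α : ℝ} (hα : -1 < α) (n a b i j : ℕ)
    (h : a + b + i + j < 2 * n) :
    ∫ z, radial (jac n α 0) z * (starRingEnd ℂ) ((z.re : ℂ) ^ a * (z.im : ℂ) ^ b *
      (z ^ i * (starRingEnd ℂ) z ^ j)) ∂(wMeasure α) = 0 := by
  have hint : ∀ a b i j : ℕ, Integrable (fun z : ℂ => radial (jac n α 0) z *
      (starRingEnd ℂ) ((z.re : ℂ) ^ a * (z.im : ℂ) ^ b * (z ^ i * (starRingEnd ℂ) z ^ j)))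
      (wMeasure α) := by
    intro a b i j
    refine integrable_wMeasure hα ((continuous_radial _).mul (Complex.continuous_conj.comp ?_))
    have h1 : Continuous fun z : ℂ => (z.re : ℂ) :=
      Complex.continuous_ofReal.comp Complex.continuous_re
    have h2 : Continuous fun z : ℂ => (z.im : ℂ) :=
      Complex.continuous_ofReal.comp Complex.continuous_im
    exact ((h1.pow a).mul (h2.pow b)).mul ((continuous_id.pow i).mul (Complex.continuous_conj.pow j))
  induction a generalizing i j with
  | zero =>
    induction b generalizing i j with
    | zero => simpa using integral_radial_jac_mul_conj hα n i j (by omega)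
    | succ b ih =>
      have e : ∀ z : ℂ, radial (jac n α 0) z * (starRingEnd ℂ) ((z.re : ℂ) ^ 0 *
          (z.im : ℂ) ^ (b + 1) * (z ^ i * (starRingEnd ℂ) z ^ j))
          = (starRingEnd ℂ) (1 / (2 * Complex.I)) * (radial (jac n α 0) z * (starRingEnd ℂ)
            ((z.re : ℂ) ^ 0 * (z.im : ℂ) ^ b * (z ^ (i + 1) * (starRingEnd ℂ) z ^ j))
          - radial (jac n α 0) z * (starRingEnd ℂ)
            ((z.re : ℂ) ^ 0 * (z.im : ℂ) ^ b * (z ^ i * (starRingEnd ℂ) z ^ (j + 1)))) := by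
        intro z
        have hz : (z.im : ℂ) = 1 / (2 * Complex.I) * (z - (starRingEnd ℂ) z) := by
          rw [Complex.sub_conj]
          have := Complex.I_ne_zero
          push_cast; field_simp
        have : (z.re : ℂ) ^ 0 * (z.im : ℂ) ^ (b + 1) * (z ^ i * (starRingEnd ℂ) z ^ j)
            = 1 / (2 * Complex.I) * ((z.re : ℂ) ^ 0 * (z.im : ℂ) ^ b *
              (z ^ (i + 1) * (starRingEnd ℂ) z ^ j) - (z.re : ℂ) ^ 0 * (z.im : ℂ) ^ b *
              (z ^ i * (starRingEnd ℂ) z ^ (j + 1))) := by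
          rw [pow_succ (z.im : ℂ) b]
          nth_rewrite 2 [hz]
          ring
        rw [this, map_mul, map_sub]; ring
      simp only [e]
      rw [integral_const_mul, integral_sub (hint _ _ _ _) (hint _ _ _ _), ih _ _ (by omega),
        ih _ _ (by omega), sub_zero, mul_zero]
  | succ a ih =>
    have e : ∀ z : ℂ, radial (jac n α 0) z * (starRingEnd ℂ) ((z.re : ℂ) ^ (a + 1) *
        (z.im : ℂ) ^ b * (z ^ i * (starRingEnd ℂ) z ^ j))
        = (starRingEnd ℂ) (1 / 2) * (radial (jac n α 0) z * (starRingEnd ℂ)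
          ((z.re : ℂ) ^ a * (z.im : ℂ) ^ b * (z ^ (i + 1) * (starRingEnd ℂ) z ^ j))
        + radial (jac n α 0) z * (starRingEnd ℂ)
          ((z.re : ℂ) ^ a * (z.im : ℂ) ^ b * (z ^ i * (starRingEnd ℂ) z ^ (j + 1)))) := by
      intro z
      have hz : (z.re : ℂ) = 1 / 2 * (z + (starRingEnd ℂ) z) := by
        rw [Complex.add_conj]; push_cast; ring
      have : (z.re : ℂ) ^ (a + 1) * (z.im : ℂ) ^ b * (z ^ i * (starRingEnd ℂ) z ^ j)
          = 1 / 2 * ((z.re : ℂ) ^ a * (z.im : ℂ) ^ b *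
            (z ^ (i + 1) * (starRingEnd ℂ) z ^ j) + (z.re : ℂ) ^ a * (z.im : ℂ) ^ b *
            (z ^ i * (starRingEnd ℂ) z ^ (j + 1))) := by
        rw [pow_succ (z.re : ℂ) a]
        nth_rewrite 2 [hz]
        ring
      rw [this, map_mul, map_add]; ring
    simp only [e]
    rw [integral_const_mul, integral_add (hint _ _ _ _) (hint _ _ _ _), ih _ _ (by omega),
      ih _ _ (by omega), add_zero, mul_zero]

theorem wInner_radial_jac {α : ℝ} (hα : -1 < α) {n N : ℕ} (hN : N < 2 * n) {q : ℂ → ℂ}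
    (hq : q ∈ polySpace N) : wInner α (radial (jac n α 0)) q = 0 := by
  obtain ⟨p, hp, rfl⟩ := hq
  have hp' : p.totalDegree ≤ N := (MvPolynomial.mem_restrictTotalDegree _ _ _).1 hp
  have e : ∀ z, radial (jac n α 0) z * (starRingEnd ℂ) (polyFun p z)
      = ∑ d ∈ p.support, (starRingEnd ℂ) (p.coeff d) * (radial (jac n α 0) z * (starRingEnd ℂ)
        ((z.re : ℂ) ^ d 0 * (z.im : ℂ) ^ d 1 * (z ^ 0 * (starRingEnd ℂ) z ^ 0))) := by
    intro z
    simp only [polyFun, LinearMap.coe_mk, AddHom.coe_mk, MvPolynomial.eval_eq', map_sum,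
      Finset.mul_sum, Fin.prod_univ_two, Matrix.cons_val_zero, Matrix.cons_val_one, map_mul]
    refine Finset.sum_congr rfl fun d _ => ?_
    simp; ring
  rw [wInner]
  simp only [e]
  rw [integral_finsetSum]
  · refine Finset.sum_eq_zero fun d hd => ?_
    have h1 := MvPolynomial.le_totalDegree hd
    rw [Finsupp.sum_fintype _ _ (by simp)] at h1
    simp only [Fin.sum_univ_two] at h1
    rw [integral_const_mul, integral_radial_jac_mul_conj_monomial hα n _ _ 0 0 (by omega), mul_zero]
  · intro d _
    refine integrable_wMeasure hα (continuous_const.mul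
      ((continuous_radial _).mul (Complex.continuous_conj.comp ?_)))
    have h1 : Continuous fun z : ℂ => (z.re : ℂ) :=
      Complex.continuous_ofReal.comp Complex.continuous_re
    have h2 : Continuous fun z : ℂ => (z.im : ℂ) :=
      Complex.continuous_ofReal.comp Complex.continuous_im
    exact ((h1.pow _).mul (h2.pow _)).mul ((continuous_id.pow 0).mul (Complex.continuous_conj.pow 0))

theorem wInner_sub {α : ℝ} (hα : -1 < α) {f g q : ℂ → ℂ} (hf : Continuous f) (hg : Continuous g)
    (hq : Continuous q) : wInner α (f - g) q = wInner α f q - wInner α g q := by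
  have h := integral_sub
    (integrable_wMeasure hα (hf.mul (Complex.continuous_conj.comp hq)))
    (integrable_wMeasure hα (hg.mul (Complex.continuous_conj.comp hq)))
  simp only [Pi.mul_apply, Function.comp] at h
  rw [wInner, wInner, wInner, ← h]
  simp only [Pi.sub_apply, sub_mul]

theorem ae_eq_zero_of_wInner_self {α : ℝ} (hα : -1 < α) {f : ℂ → ℂ} (hf : Continuous f)
    (h : wInner α f f = 0) : f =ᵐ[wMeasure α] 0 := by
  have h1 : wInner α f f = ((∫ z, ‖f z‖ ^ 2 ∂(wMeasure α) : ℝ) : ℂ) := by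
    rw [wInner, ← integral_complex_ofReal]
    refine integral_congr_ae (Eventually.of_forall fun z => ?_)
    simp only [Complex.mul_conj, Complex.normSq_eq_norm_sq]
  rw [h1, Complex.ofReal_eq_zero, integral_eq_zero_iff_of_nonneg (fun _ => by positivity)
    ((memLp_two_iff_integrable_sq_norm hf.aestronglyMeasurable).1 (memLp_wMeasure hα hf 2))] at h
  filter_upwards [h] with z hz
  simpa using hz

/-- p is an admissible projection, so the chosen one exists; the difference of the two lies in the
space and is orthogonal to itself. -/
theorem sub_proj_ae_eq {α : ℝ} (hα : -1 < α) {N : ℕ} {f p : ℂ → ℂ} (hf : Continuous f)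
    (hp : p ∈ polySpace N) (horth : ∀ q ∈ polySpace N, wInner α f q = 0) :
    (f + p) - proj α N (f + p) =ᵐ[wMeasure α] f := by
  have hex : ∃ p' ∈ polySpace N, ∀ q ∈ polySpace N, wInner α (f + p - p') q = 0 :=
    ⟨p, hp, fun q hq => by rw [add_sub_cancel_right]; exact horth q hq⟩
  have hproj : proj α N (f + p) = hex.choose := by rw [proj, dif_pos hex]
  rw [hproj]
  obtain ⟨h1, h2⟩ := hex.choose_spec
  set p' := hex.choose
  have hd : p - p' ∈ polySpace N := Submodule.sub_mem _ hp h1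
  have hc := continuous_of_mem_polySpace hp
  have hc' := continuous_of_mem_polySpace h1
  have h3 : wInner α (p - p') (p - p') = 0 := by
    have := wInner_sub hα ((hf.add hc).sub hc') hf (continuous_of_mem_polySpace hd)
    rw [h2 _ hd, horth _ hd, sub_zero] at this
    rw [← this]; congr 1; abel
  filter_upwards [ae_eq_zero_of_wInner_self hα (continuous_of_mem_polySpace hd) h3] with z hz
  simp only [Pi.sub_apply, Pi.add_apply, Pi.zero_apply] at hz ⊢
  rw [add_sub_assoc, hz, add_zero]

theorem residual_ae_eq {α : ℝ} (hα : -1 < α) (l j : ℕ) (hj : 1 ≤ j) :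
    residual α l j =ᵐ[wMeasure α]
      fun z => ((tScale α l j * connCoeff α l (j + l) 0 : ℝ) : ℂ) * radial (jac (j + l) α 0) z := by
  have hj0 : (0 : ℝ) ≤ j := by positivity
  set f : ℂ → ℂ := fun z =>
    ((tScale α l j * connCoeff α l (j + l) 0 : ℝ) : ℂ) * radial (jac (j + l) α 0) z with hf
  set Q : ℝ[X] := ∑ k ∈ Finset.range l,
    C (connCoeff α l (j + l) (k + 1)) * jac (j + l - (k + 1)) α 0 with hQ
  have hQd : Q.natDegree ≤ j + l - 1 := by
    refine natDegree_sum_le_of_forall_le _ _ fun k hk => ?_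
    refine (natDegree_C_mul_le _ _).trans ((natDegree_jac_le _ _ _).trans (by omega))
  set p : ℂ → ℂ := (tScale α l j : ℂ) • radial Q with hp
  have hpm : p ∈ polySpace (truncDeg l j) :=
    Submodule.smul_mem _ _ (radial_mem_polySpace (by unfold truncDeg; omega))
  have ht : tPoly α l j = f + p := by
    rw [tPoly_eq hα, jac_connection α l (j + l) (by omega) (by push_cast; linarith),
      Finset.sum_range_succ', ← hQ]
    funext z
    simp only [Pi.add_apply, hf, hp, Pi.smul_apply, radial_add, smul_eq_mul, Nat.sub_zero]
    simp [radial]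
    ring
  rw [residual, ht]
  refine sub_proj_ae_eq hα (continuous_const.mul (continuous_radial _)) hpm fun q hq => ?_
  -- Here `1 ≤ j` prevents the truncation of `truncDeg` at zero when l = 0, a case used for the L²
  -- estimate with k = 0.
  have := wInner_radial_jac hα (n := j + l) (by unfold truncDeg; omega) hq
  rw [wInner] at this ⊢
  simp only [hf, mul_assoc, integral_const_mul, this, mul_zero]

/-! ### Asymptotics of norms as the degree tends to infinity -/

theorem tendsto_affine_div (b c : ℝ) :
    Tendsto (fun n : ℕ => (b * n + c) / n) atTop (𝓝 b) := by
  have h : Tendsto (fun n : ℕ => b + c / (n : ℝ)) atTop (𝓝 (b + 0)) :=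
    tendsto_const_nhds.add (tendsto_const_div_atTop_nhds_zero_nat c)
  rw [add_zero] at h
  refine h.congr' ?_
  filter_upwards [eventually_gt_atTop 0] with n hn
  have : (n : ℝ) ≠ 0 := by positivity
  field_simp

theorem tendsto_poch_div (b c : ℝ) (m : ℕ) :
    Tendsto (fun n : ℕ => poch (b * n + c) m / (n : ℝ) ^ m) atTop (𝓝 (b ^ m)) := by
  have h : Tendsto (fun n : ℕ => ∏ i ∈ Finset.range m, (b * n + (c + i)) / (n : ℝ)) atTop
      (𝓝 (∏ _i ∈ Finset.range m, b)) :=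
    tendsto_finsetProd _ fun i _ => tendsto_affine_div b (c + i)
  simp only [Finset.prod_const, Finset.card_range, Finset.prod_div_distrib] at h
  refine h.congr fun n => ?_
  congr 1
  exact Finset.prod_congr rfl fun i _ => by ring

theorem tendsto_descFactorial_div (m : ℕ) :
    Tendsto (fun n : ℕ => (n.descFactorial m : ℝ) / (n : ℝ) ^ m) atTop (𝓝 1) := by
  have h : Tendsto (fun n : ℕ => ∏ i ∈ Finset.range m, (1 * n + (-(i : ℝ))) / (n : ℝ)) atTop
      (𝓝 (∏ _i ∈ Finset.range m, 1)) :=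
    tendsto_finsetProd _ fun i _ => tendsto_affine_div 1 (-(i : ℝ))
  simp only [Finset.prod_const, Finset.card_range, Finset.prod_div_distrib, one_pow] at h
  refine h.congr' ?_
  filter_upwards [eventually_ge_atTop m] with n hn
  congr 1
  rw [Nat.descFactorial_eq_prod_range]
  push_cast
  refine Finset.prod_congr rfl fun i hi => ?_
  have : i ≤ n := by simp at hi; omega
  rw [Nat.cast_sub this]; ring

/-- The integral of `(1 - x) ^ d * jac m (α - s) d ^ 2` with the weight `x ^ α`. -/
def jacSq (α : ℝ) (s d m : ℕ) : ℝ :=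
  wInt α ((1 - X) ^ d * (jac m (α - s) d * jac m (α - s) d))

theorem wInt_mul_sq_nonneg {α : ℝ} (hα : -1 < α) (d : ℕ) (P : ℝ[X]) :
    0 ≤ wInt α ((1 - X) ^ d * (P * P)) := by
  have h := normSq_angRadial hα d 0 P
  have h2 := normSq_nonneg α (angRadial d 0 P)
  rw [h, add_zero] at h2
  exact nonneg_of_mul_nonneg_right h2 Real.pi_pos

/-- From (uP - vQ)² + (uP + vQ)² = 2u²P² + 2v²Q², where the integral of the second square is
nonnegative. -/
theorem sq_mul_wInt_le {α : ℝ} (hα : -1 < α) (d : ℕ) {b u v : ℝ} {P Q R : ℝ[X]}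
    (h : C b * R = C u * P - C v * Q) :
    b ^ 2 * wInt α ((1 - X) ^ d * (R * R)) ≤ 2 * u ^ 2 * wInt α ((1 - X) ^ d * (P * P))
      + 2 * v ^ 2 * wInt α ((1 - X) ^ d * (Q * Q)) := by
  have hn := wInt_mul_sq_nonneg hα d (C u * P + C v * Q)
  have e : C (b ^ 2) * ((1 - X) ^ d * (R * R))
      + (1 - X) ^ d * ((C u * P + C v * Q) * (C u * P + C v * Q))
      = C (2 * u ^ 2) * ((1 - X) ^ d * (P * P)) + C (2 * v ^ 2) * ((1 - X) ^ d * (Q * Q)) := by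
    have c2 : (C 2 : ℝ[X]) = 2 := rfl
    simp only [C_mul, C_pow, c2]
    linear_combination (1 - X) ^ d * (C b * R + (C u * P - C v * Q)) * h
  have e' := congrArg (wInt α) e
  rw [map_add, map_add, wInt_C_mul, wInt_C_mul, wInt_C_mul] at e'
  linarith

theorem tendsto_mul_jacSq {α : ℝ} (hα : -1 < α) (d : ℕ) :
    Tendsto (fun m : ℕ => (m : ℝ) * jacSq α 0 d m) atTop (𝓝 (1 / 2)) := by
  have h1 := tendsto_poch_div 1 1 d
  have h2 := tendsto_poch_div 1 (α + 1) d
  have h3 := tendsto_affine_div 2 (α + d + 1)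
  have h := (h1.div h2 (by simp)).mul (h3.inv₀ two_ne_zero)
  simp only [one_pow, div_one, one_mul] at h
  rw [one_div]
  refine h.congr' ?_
  filter_upwards [eventually_gt_atTop 0] with m hm
  have hm' : (m : ℝ) ≠ 0 := by positivity
  have e := wInt_jac_sq hα m d
  rw [jacSq, Nat.cast_zero, sub_zero, e]
  have : (0 : ℝ) < m := by positivity
  have hd : (0 : ℝ) ≤ d := by positivity
  have p1 : poch ((m : ℝ) + (α + 1)) d ≠ 0 := (poch_pos (by linarith) d).ne'
  have p2 : (m : ℝ) + α + 1 = m + (α + 1) := by ring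
  have hm1 : (1 : ℝ) ≤ m := by exact_mod_cast hm
  have p3 : 2 * (m : ℝ) + (α + d + 1) ≠ 0 := by linarith
  have p4 : 2 * (m : ℝ) + α + d + 1 = 2 * (m : ℝ) + (α + d + 1) := by ring
  simp only [Pi.div_apply]
  rw [p2, p4]
  field_simp

/-- For s = 0 the exact norm decays like 1/m. Each further lowering of the parameter is a contiguous
relation, and after division by its leading factor its coefficients are bounded by one for large m.
-/
theorem tendsto_jacSq {α : ℝ} (hα : -1 < α) (s d : ℕ) :
    Tendsto (jacSq α s d) atTop (𝓝 0) := by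
  induction s with
  | zero =>
    have h := (tendsto_mul_jacSq hα d).mul tendsto_one_div_atTop_nhds_zero_nat
    rw [mul_zero] at h
    refine h.congr' ?_
    filter_upwards [eventually_gt_atTop 0] with m hm
    have hm' : (m : ℝ) ≠ 0 := by positivity
    field_simp
  | succ s ih =>
    rw [← tendsto_add_atTop_iff_nat 1]
    have hb : Tendsto (fun m => 2 * jacSq α s d (m + 1) + 2 * jacSq α s d m) atTop
        (𝓝 (2 * 0 + 2 * 0)) :=
      (((tendsto_add_atTop_iff_nat 1).2 ih).const_mul 2).add (ih.const_mul 2)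
    rw [mul_zero, add_zero] at hb
    refine tendsto_of_tendsto_of_tendsto_of_le_of_le' tendsto_const_nhds hb
      (Eventually.of_forall fun m => wInt_mul_sq_nonneg hα _ _) ?_
    -- For m > |α - s| both coefficients u and v lie between 0 and b.
    obtain ⟨M, hM⟩ := exists_nat_gt (|α - s|)
    filter_upwards [eventually_ge_atTop M] with m hm
    have hm' : |α - s| < m := hM.trans_le (by exact_mod_cast hm)
    have hab := abs_lt.1 hm'
    have hd : (0 : ℝ) ≤ d := by positivity
    have hc := jac_contiguous m (α - s) d
    set b := 2 * (m : ℝ) + 2 + (α - s) + d with hbdef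
    set u := (m : ℝ) + 1 + (α - s) + d with hu
    set v := (m : ℝ) + 1 + d with hv
    have hb0 : 0 < b := by rw [hbdef]; linarith
    have hub : u ^ 2 ≤ b ^ 2 := by
      apply pow_le_pow_left₀ <;> rw [hu] <;> linarith
    have hvb : v ^ 2 ≤ b ^ 2 := by
      apply pow_le_pow_left₀ <;> rw [hv] <;> linarith
    have e1 : α - ((s + 1 : ℕ) : ℝ) = α - s - 1 := by push_cast; ring
    have hn1 := wInt_mul_sq_nonneg hα d (jac (m + 1) (α - s) d)
    have hn2 := wInt_mul_sq_nonneg hα d (jac m (α - s) d)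
    have key := sq_mul_wInt_le hα d hc
    rw [jacSq, jacSq, jacSq, e1]
    have hb2 : 0 < b ^ 2 := by positivity
    refine le_of_mul_le_mul_left ?_ hb2
    nlinarith [mul_le_mul_of_nonneg_right hub hn1, mul_le_mul_of_nonneg_right hvb hn2]

theorem wirtSq_eq (α : ℝ) (n l p q : ℕ) (h : p + q ≤ l) :
    wirtSq α n (α - l) p q = (poch (1 * n + (α - l + 1)) (max p q) * n.descFactorial (min p q)) ^ 2 *
      (Real.pi * jacSq α (l - (p + q)) (q - p + (p - q)) (n - max p q)) := by
  rw [wirtSq, jacSq]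
  have e1 : α - (l : ℝ) + p + q = α - ((l - (p + q) : ℕ) : ℝ) := by
    rw [Nat.cast_sub h]; push_cast; ring
  have e2 : (n : ℝ) + (α - l) + 1 = 1 * n + (α - l + 1) := by ring
  rw [e1, e2]

/-- For p + q = l the first parameter equals the weight exponent α, so the exact norm applies:
1/(2n) to leading order, times π and the squared factor n^(2l). The limit is the same for all p. -/
theorem tendsto_wirtSq_top {α : ℝ} (hα : -1 < α) (l p : ℕ) (hp : p ≤ l) :
    Tendsto (fun n : ℕ => (n : ℝ) * wirtSq α n (α - l) p (l - p) / (n : ℝ) ^ (2 * l)) atTop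
      (𝓝 (Real.pi / 2)) := by
  set M := max p (l - p) with hM
  set m := min p (l - p) with hm
  have hl : M + m = l := by omega
  have h1 := tendsto_poch_div 1 (α - l + 1) M
  have h2 := tendsto_descFactorial_div m
  have h3 := (tendsto_mul_jacSq hα (l - p - p + (p - (l - p)))).comp (tendsto_sub_atTop_nat M)
  have h4 := (tendsto_affine_div 1 (-(M : ℝ))).inv₀ one_ne_zero
  have h := (((h1.mul h2).pow 2).mul ((h3.mul h4).const_mul Real.pi))
  simp only [one_pow, one_mul, inv_one, mul_one, mul_one_div] at h
  refine h.congr' ?_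
  filter_upwards [eventually_gt_atTop M] with n hn
  rw [wirtSq_eq α n l p (l - p) (by omega), ← hM, ← hm, show l - (p + (l - p)) = 0 by omega]
  have hn0 : (n : ℝ) ≠ 0 := by
    have : 0 < n := by omega
    positivity
  have hnM : (n : ℝ) + -(M : ℝ) ≠ 0 := by
    have : (M : ℝ) < n := by exact_mod_cast hn
    linarith
  have hpow : (n : ℝ) ^ (2 * l) = ((n : ℝ) ^ M * (n : ℝ) ^ m) ^ 2 := by
    rw [← pow_add, hl, ← pow_mul, mul_comm]
  rw [hpow]
  simp only [Function.comp, one_mul, Nat.cast_sub hn.le]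
  field_simp
  ring

theorem tendsto_wirtSq_low {α : ℝ} (hα : -1 < α) (l p q : ℕ) (hp : p + q < l) :
    Tendsto (fun n : ℕ => (n : ℝ) * wirtSq α n (α - l) p q / (n : ℝ) ^ (2 * l)) atTop (𝓝 0) := by
  set M := max p q with hM
  set m := min p q with hm
  have h1 := tendsto_poch_div 1 (α - l + 1) M
  have h2 := tendsto_descFactorial_div m
  have h3 := (tendsto_jacSq hα (l - (p + q)) (q - p + (p - q))).comp (tendsto_sub_atTop_nat M)
  -- The derivative has order p + q < l, so its squared factor n^(2(p+q)) leaves at least one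
  -- negative power of n even after multiplication by n.
  have h4 := (tendsto_one_div_atTop_nhds_zero_nat (𝕜 := ℝ)).pow (2 * (l - (p + q)) - 1)
  have h := (((h1.mul h2).pow 2).mul ((h3.mul h4).const_mul Real.pi))
  simp only [zero_mul, mul_zero] at h
  refine h.congr' ?_
  filter_upwards [eventually_gt_atTop 0] with n hn
  rw [wirtSq_eq α n l p q hp.le, ← hM, ← hm]
  have hn0 : (n : ℝ) ≠ 0 := by positivity
  have hpow : (n : ℝ) ^ (2 * l)
      = ((n : ℝ) ^ M * (n : ℝ) ^ m) ^ 2 * ((n : ℝ) * (n : ℝ) ^ (2 * (l - (p + q)) - 1)) := by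
    rw [← pow_add, ← pow_mul, ← pow_succ', ← pow_add]
    congr 1; omega
  rw [hpow]
  simp only [Function.comp, one_div, inv_pow]
  field_simp

theorem symbWeight_nonneg (k p : ℕ) : 0 ≤ symbWeight k p :=
  Finset.sum_nonneg fun _ _ => by positivity

theorem sum_symbWeight_pos (k : ℕ) : 0 < ∑ p ∈ Finset.range (k + 1), symbWeight k p := by
  -- The derivative ∂₁^k suffices: its symbol (X + 1)^k has leading coefficient 1.
  refine Finset.sum_pos' (fun _ _ => symbWeight_nonneg _ _) ⟨k, by simp, ?_⟩
  refine Finset.sum_pos' (fun _ _ => by positivity) ⟨(k, 0), by simp, ?_⟩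
  have : (symb k 0).coeff k = 1 := by
    rw [symb, pow_zero, mul_one]
    simp [coeff_X_add_one_pow]
  rw [this]; norm_num

/-- The squared Sobolev seminorm of order `k` of the radial Jacobi polynomial. -/
def jacSemiSq (α : ℝ) (n : ℕ) (a : ℝ) (k : ℕ) : ℝ := seminorm α k (radial (jac n a 0)) ^ 2

theorem tendsto_jacSemiSq_top {α : ℝ} (hα : -1 < α) (l : ℕ) :
    Tendsto (fun n : ℕ => (n : ℝ) * jacSemiSq α n (α - l) l / (n : ℝ) ^ (2 * l)) atTop
      (𝓝 ((∑ p ∈ Finset.range (l + 1), symbWeight l p) * (Real.pi / 2))) := by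
  have h := tendsto_finsetSum (Finset.range (l + 1)) fun p hp =>
    (tendsto_wirtSq_top hα l p (by simp at hp; omega)).const_mul (symbWeight l p)
  rw [Finset.sum_mul]
  refine h.congr' ?_
  filter_upwards [eventually_ge_atTop l] with n hn
  rw [jacSemiSq, seminorm_sq_radial_jac hα n _ l hn, Finset.mul_sum, Finset.sum_div]
  exact Finset.sum_congr rfl fun p _ => by ring

theorem tendsto_jacSemiSq_low {α : ℝ} (hα : -1 < α) (l k : ℕ) (hk : k < l) :
    Tendsto (fun n : ℕ => (n : ℝ) * jacSemiSq α n (α - l) k / (n : ℝ) ^ (2 * l)) atTop (𝓝 0) := by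
  have h := tendsto_finsetSum (Finset.range (k + 1)) fun p hp =>
    (tendsto_wirtSq_low hα l p (k - p) (by simp at hp; omega)).const_mul (symbWeight k p)
  simp only [mul_zero, Finset.sum_const_zero] at h
  refine h.congr' ?_
  filter_upwards [eventually_ge_atTop k] with n hn
  rw [jacSemiSq, seminorm_sq_radial_jac hα n _ k hn, Finset.mul_sum, Finset.sum_div]
  exact Finset.sum_congr rfl fun p _ => by ring

theorem tendsto_jacSobSq {α : ℝ} (hα : -1 < α) (l : ℕ) :
    Tendsto (fun n : ℕ => (n : ℝ) * (∑ k ∈ Finset.range (l + 1), jacSemiSq α n (α - l) k) /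
      (n : ℝ) ^ (2 * l)) atTop
      (𝓝 ((∑ p ∈ Finset.range (l + 1), symbWeight l p) * (Real.pi / 2))) := by
  have h1 := tendsto_finsetSum (Finset.range l) fun k hk =>
    tendsto_jacSemiSq_low hα l k (by simpa using hk)
  have h := h1.add (tendsto_jacSemiSq_top hα l)
  rw [Finset.sum_const_zero, zero_add] at h
  refine h.congr fun n => ?_
  rw [Finset.sum_range_succ, mul_add, add_div, Finset.mul_sum, Finset.sum_div]

/-- The first parameter starts at α here, so the gradient has α + 1 against the weight x^α. The
squared seminorm grows like n², whereas starting from α - 1 it would grow like n. -/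
theorem tendsto_jacSemiSq_one {α : ℝ} (hα : -1 < α) :
    Tendsto (fun n : ℕ => (n : ℝ) * jacSemiSq α n α 1 / (n : ℝ) ^ 3) atTop
      (𝓝 ((∑ p ∈ Finset.range 2, symbWeight 1 p) * (Real.pi / (α + 1)))) := by
  have h := (tendsto_affine_div 1 (α + 1)).const_mul
    ((∑ p ∈ Finset.range 2, symbWeight 1 p) * (Real.pi / (α + 1)))
  rw [mul_one] at h
  refine h.congr' ?_
  filter_upwards [eventually_gt_atTop 0] with n hn
  obtain ⟨m, rfl⟩ : ∃ m, n = m + 1 := ⟨n - 1, by omega⟩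
  have hd := wInt_jac_deriv_sq hα m
  have ha : α + 1 ≠ 0 := by linarith
  have hm : (0 : ℝ) ≤ m := by positivity
  have hma : (m : ℝ) + α + 2 ≠ 0 := by linarith
  have hm1 : (m : ℝ) + 1 ≠ 0 := by linarith
  have hI : wInt α ((1 - X) * (jac m (α + 1) 1 * jac m (α + 1) 1))
      = (m + 1) / ((m + α + 2) * (α + 1)) := by
    field_simp; linarith
  have e1 : ((m + 1 : ℕ) : ℝ) + α + 1 = m + α + 2 := by push_cast; ring
  have w0 : wirtSq α (m + 1) α 0 1 = Real.pi * (m + 1) * (m + α + 2) / (α + 1) := by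
    simp only [wirtSq, poch, e1]
    simp [hI]
    field_simp
  have w1 : wirtSq α (m + 1) α 1 0 = Real.pi * (m + 1) * (m + α + 2) / (α + 1) := by
    simp only [wirtSq, poch, e1]
    simp [hI]
    field_simp
  rw [jacSemiSq, seminorm_sq_radial_jac hα (m + 1) _ 1 (by omega)]
  simp only [Finset.sum_range_succ, Finset.sum_range_zero, Nat.sub_self, Nat.sub_zero, w0, w1]
  push_cast
  field_simp
  ring

theorem tendsto_connCoeff_zero (α : ℝ) (l : ℕ) :
    Tendsto (fun n : ℕ => connCoeff α l n 0) atTop (𝓝 (1 / 2 ^ l)) := by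
  have h1 := tendsto_poch_div 1 (α - l + 1) l
  have h2 := tendsto_affine_div 2 (α + 1)
  have h3 := tendsto_poch_div 2 (α - l + 1) (l + 1)
  have h := (h1.mul h2).div h3 (by positivity)
  have e : (1 : ℝ) ^ l * 2 / 2 ^ (l + 1) = 1 / 2 ^ l := by
    rw [one_pow, pow_succ]; field_simp
  rw [e] at h
  refine h.congr' ?_
  filter_upwards [eventually_gt_atTop 0] with n hn
  have hn0 : (n : ℝ) ≠ 0 := by positivity
  have e1 : (n : ℝ) + α - l + 1 = 1 * n + (α - l + 1) := by ring
  have e2 : 2 * (n : ℝ) + α - l - ((0 : ℕ) : ℝ) + 1 = 2 * n + (α - l + 1) := by push_cast; ring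
  rw [connCoeff, e1, e2]
  simp only [Pi.div_apply, pow_succ, pow_zero, Nat.choose_zero_right,
    Nat.descFactorial_zero, Nat.sub_zero, Nat.cast_one, Nat.cast_zero, mul_zero, sub_zero, one_mul,
    mul_one]
  rw [add_assoc (2 * (n : ℝ)) α 1]
  by_cases hD : poch (2 * (n : ℝ) + (α - l + 1)) (l + 1) = 0
  · simp [hD]
  field_simp

/-! ### From squared quotients to rates, and sharpness -/

/-- Passes from integer powers of n = j + l in squared quantities to the real exponent 3r/2 - l. The
scale g is arbitrary up to g ~ ρ j, so that j, N and N + 1 are all covered. -/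
theorem tendsto_div_rpow_of_sq {x : ℕ → ℝ} (hx : ∀ j, 0 ≤ x j) (l r : ℕ) {c : ℝ} (hc : 0 < c)
    (h : Tendsto (fun j : ℕ => x j ^ 2 * ((j + l : ℕ) : ℝ) ^ (2 * l) / ((j + l : ℕ) : ℝ) ^ (3 * r))
      atTop (𝓝 c)) {g : ℕ → ℝ} {ρ : ℝ} (hρ : 0 < ρ)
    (hg : Tendsto (fun j : ℕ => g j / (j : ℝ)) atTop (𝓝 ρ)) :
    ∃ C : ℝ, 0 < C ∧ Tendsto (fun j : ℕ => x j / g j ^ (3 / 2 * (r : ℝ) - l)) atTop (𝓝 C) := by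
  set e : ℝ := 3 / 2 * (r : ℝ) - l with he
  have h1 : Tendsto (fun j : ℕ => ((1 : ℝ) * j + l) / j) atTop (𝓝 1) := tendsto_affine_div 1 l
  have h2 := ((h1.div hg hρ.ne').rpow_const (p := e) (Or.inl (by positivity)))
  have h3 := h.sqrt
  refine ⟨√c * (1 / ρ) ^ e, by positivity, (h3.mul h2).congr' ?_⟩
  filter_upwards [eventually_gt_atTop 0, hg.eventually_const_lt hρ] with j hj hgj
  have hj0 : (0 : ℝ) < j := by exact_mod_cast hj
  have hg0 : 0 < g j := (div_pos_iff_of_pos_right hj0).1 hgj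
  obtain ⟨n, hn⟩ : ∃ n : ℝ, n = ((j + l : ℕ) : ℝ) := ⟨_, rfl⟩
  have hn0 : 0 < n := by rw [hn]; positivity
  have e1 : ((1 : ℝ) * j + l) / j / (g j / j) = n / g j := by
    rw [hn]; push_cast; field_simp
  have e2 : n ^ (3 * r) / n ^ (2 * l) = (n ^ e) ^ 2 := by
    rw [← Real.rpow_natCast, ← Real.rpow_natCast, ← Real.rpow_natCast, ← Real.rpow_mul hn0.le,
      ← Real.rpow_sub hn0, he]
    congr 1; push_cast; ring
  have hne : 0 < n ^ e := by positivity
  have e3 : x j ^ 2 * n ^ (2 * l) / n ^ (3 * r) = (x j / n ^ e) ^ 2 := by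
    rw [div_pow, ← e2]; field_simp
  simp only [Pi.div_apply]
  rw [e1, ← hn, e3, Real.sqrt_sq (div_nonneg (hx j) hne.le), Real.div_rpow hn0.le hg0.le]
  have hge : 0 < g j ^ e := by positivity
  field_simp

theorem isEquivalent_of_tendsto_div {x y : ℕ → ℝ} {C : ℝ} (hC : 0 < C)
    (h : Tendsto (fun j => x j / y j) atTop (𝓝 C)) : x ~[atTop] fun j => C * y j := by
  refine isEquivalent_of_tendsto_one ?_
  have h2 := h.div_const C
  rw [div_self hC.ne'] at h2
  refine h2.congr fun j => ?_
  simp only [Pi.div_apply]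
  rw [div_div, mul_comm]

theorem tendsto_truncDeg_div (l : ℕ) :
    Tendsto (fun j : ℕ => (truncDeg l j : ℝ) / (j : ℝ)) atTop (𝓝 2) := by
  refine (tendsto_affine_div 2 (2 * (l : ℝ) - 1)).congr' ?_
  filter_upwards [eventually_gt_atTop 0] with j hj
  rw [truncDeg, Nat.cast_sub (by omega)]
  push_cast; congr 1; ring

theorem tendsto_truncDeg_add_one_div (l : ℕ) :
    Tendsto (fun j : ℕ => ((truncDeg l j : ℝ) + 1) / (j : ℝ)) atTop (𝓝 2) := by
  refine (tendsto_affine_div 2 (2 * (l : ℝ))).congr' ?_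
  filter_upwards [eventually_gt_atTop 0] with j hj
  rw [truncDeg, Nat.cast_sub (by omega)]
  push_cast; congr 1; ring

theorem seminorm_sq_residual {α : ℝ} (hα : -1 < α) (l j k : ℕ) (hj : 1 ≤ j) :
    seminorm α k (residual α l j) ^ 2
      = (tScale α l j * connCoeff α l (j + l) 0) ^ 2 * jacSemiSq α (j + l) α k := by
  rw [seminorm_congr α k (residual_ae_eq hα l j hj),
    seminorm_sq_const_mul hα (contDiff_radial _), jacSemiSq]

theorem sobolevNorm_sq_residual {α : ℝ} (hα : -1 < α) (l j k : ℕ) (hj : 1 ≤ j) :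
    sobolevNorm α k (residual α l j) ^ 2 = (tScale α l j * connCoeff α l (j + l) 0) ^ 2 *
      ∑ i ∈ Finset.range (k + 1), jacSemiSq α (j + l) α i := by
  rw [sobolevNorm_congr α k (residual_ae_eq hα l j hj),
    sobolevNorm_sq hα k (contDiff_const.mul (contDiff_radial _)), Finset.mul_sum]
  exact Finset.sum_congr rfl fun i _ => seminorm_sq_const_mul hα (contDiff_radial _) _ _

theorem contDiff_tPoly {α : ℝ} (hα : -1 < α) (l j : ℕ) : ContDiff ℝ ∞ (tPoly α l j) := by
  rw [tPoly_eq hα]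
  exact contDiff_const.mul (contDiff_radial _)

theorem seminorm_sq_tPoly {α : ℝ} (hα : -1 < α) (l j k : ℕ) :
    seminorm α k (tPoly α l j) ^ 2 = tScale α l j ^ 2 * jacSemiSq α (j + l) (α - l) k := by
  rw [tPoly_eq hα, seminorm_sq_const_mul hα (contDiff_radial _), jacSemiSq]

theorem sobolevNorm_sq_tPoly {α : ℝ} (hα : -1 < α) (l j k : ℕ) :
    sobolevNorm α k (tPoly α l j) ^ 2
      = tScale α l j ^ 2 * ∑ i ∈ Finset.range (k + 1), jacSemiSq α (j + l) (α - l) i := by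
  rw [sobolevNorm_sq hα k (contDiff_tPoly hα l j), Finset.mul_sum]
  exact Finset.sum_congr rfl fun i _ => seminorm_sq_tPoly hα l j i

/-- A and B stand for squared seminorms or squared norms of the Jacobi polynomials with parameters α
and α - l. The common factor `tScale` of residual and t_j cancels. -/
theorem tendsto_ratio_sq {α : ℝ} (hα : -1 < α) (l r : ℕ) {x A B : ℕ → ℝ} {cA cB : ℝ}
    (hcA : 0 < cA) (hcB : 0 < cB)
    (hx : ∀ j, 1 ≤ j → x j ^ 2 = (tScale α l j * connCoeff α l (j + l) 0) ^ 2 * A (j + l) /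
      (tScale α l j ^ 2 * B (j + l)))
    (hA : Tendsto (fun n : ℕ => (n : ℝ) * A n / (n : ℝ) ^ (3 * r)) atTop (𝓝 cA))
    (hB : Tendsto (fun n : ℕ => (n : ℝ) * B n / (n : ℝ) ^ (2 * l)) atTop (𝓝 cB)) :
    ∃ c : ℝ, 0 < c ∧ Tendsto (fun j : ℕ => x j ^ 2 * ((j + l : ℕ) : ℝ) ^ (2 * l) /
      ((j + l : ℕ) : ℝ) ^ (3 * r)) atTop (𝓝 c) := by
  have h := ((((tendsto_connCoeff_zero α l).pow 2).mul hA).div hB hcB.ne').comp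
    (tendsto_add_atTop_nat l)
  refine ⟨_, ?_, h.congr' ?_⟩
  · positivity
  filter_upwards [eventually_ge_atTop 1] with j hj
  have hs := (tScale_pos hα l j).ne'
  have hn : ((j + l : ℕ) : ℝ) ≠ 0 := by
    have : 0 < j + l := by omega
    positivity
  rw [hx j hj]
  simp only [Function.comp, Pi.div_apply]
  by_cases hB0 : B (j + l) = 0
  · simp [hB0]
  field_simp

theorem exists_rates {α : ℝ} (hα : -1 < α) (l r : ℕ) {x A B : ℕ → ℝ} {cA cB : ℝ}
    (hcA : 0 < cA) (hcB : 0 < cB) (hx0 : ∀ j, 0 ≤ x j)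
    (hx : ∀ j, 1 ≤ j → x j ^ 2 = (tScale α l j * connCoeff α l (j + l) 0) ^ 2 * A (j + l) /
      (tScale α l j ^ 2 * B (j + l)))
    (hA : Tendsto (fun n : ℕ => (n : ℝ) * A n / (n : ℝ) ^ (3 * r)) atTop (𝓝 cA))
    (hB : Tendsto (fun n : ℕ => (n : ℝ) * B n / (n : ℝ) ^ (2 * l)) atTop (𝓝 cB))
    {g : ℕ → ℝ} {ρ : ℝ} (hρ : 0 < ρ) (hg : Tendsto (fun j : ℕ => g j / (j : ℝ)) atTop (𝓝 ρ)) :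
    ∃ C : ℝ, 0 < C ∧ Tendsto (fun j : ℕ => x j / g j ^ (3 / 2 * (r : ℝ) - l)) atTop (𝓝 C) := by
  obtain ⟨c, hc, h⟩ := tendsto_ratio_sq hα l r hcA hcB hx hA hB
  exact tendsto_div_rpow_of_sq hx0 l r hc h hρ hg

theorem exists_tendsto_jacSemiSq {α : ℝ} (hα : -1 < α) {r : ℕ} (hr : r ≤ 1) :
    ∃ c : ℝ, 0 < c ∧
      Tendsto (fun n : ℕ => (n : ℝ) * jacSemiSq α n α r / (n : ℝ) ^ (3 * r)) atTop (𝓝 c) := by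
  have hπ := Real.pi_pos
  have ha : 0 < α + 1 := by linarith
  interval_cases r
  · have h := tendsto_jacSemiSq_top hα 0
    simp only [Nat.cast_zero, sub_zero] at h
    exact ⟨_, mul_pos (sum_symbWeight_pos 0) (by positivity), h⟩
  · exact ⟨_, mul_pos (sum_symbWeight_pos 1) (by positivity), tendsto_jacSemiSq_one hα⟩

theorem exists_tendsto_jacSobSq {α : ℝ} (hα : -1 < α) {r : ℕ} (hr : r ≤ 1) :
    ∃ c : ℝ, 0 < c ∧
      Tendsto (fun n : ℕ => (n : ℝ) * (∑ i ∈ Finset.range (r + 1), jacSemiSq α n α i) /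
        (n : ℝ) ^ (3 * r)) atTop (𝓝 c) := by
  interval_cases r
  · simpa using exists_tendsto_jacSemiSq hα zero_le_one
  · obtain ⟨c0, -, h0⟩ := exists_tendsto_jacSemiSq hα zero_le_one
    obtain ⟨c1, hc1, h1⟩ := exists_tendsto_jacSemiSq hα le_rfl
    refine ⟨c1, hc1, ?_⟩
    -- The squared L² norm is of order 1/n, hence negligible against the squared H¹ seminorm of
    -- order n².
    have hz := (tendsto_one_div_atTop_nhds_zero_nat (𝕜 := ℝ)).pow 3
    have h := (h0.mul hz).add h1
    norm_num at h
    refine h.congr fun n => ?_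
    simp only [Finset.sum_range_succ, Finset.sum_range_zero, zero_add]
    ring

theorem tendsto_seminorm_ratio {α : ℝ} (hα : -1 < α) (l : ℕ) {r : ℕ} (hr : r ≤ 1)
    {g : ℕ → ℝ} {ρ : ℝ} (hρ : 0 < ρ) (hg : Tendsto (fun j : ℕ => g j / (j : ℝ)) atTop (𝓝 ρ)) :
    ∃ C : ℝ, 0 < C ∧ Tendsto (fun j : ℕ => seminorm α r (residual α l j) /
      seminorm α l (tPoly α l j) / g j ^ (3 / 2 * (r : ℝ) - l)) atTop (𝓝 C) := by
  obtain ⟨cA, hcA, hA⟩ := exists_tendsto_jacSemiSq hα hr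
  refine exists_rates hα l r hcA (mul_pos (sum_symbWeight_pos l) (half_pos Real.pi_pos))
    (fun j => div_nonneg (seminorm_nonneg _ _ _) (seminorm_nonneg _ _ _)) (fun j hj => ?_) hA
    (tendsto_jacSemiSq_top hα l) hρ hg
  rw [div_pow, seminorm_sq_residual hα l j r hj, seminorm_sq_tPoly hα]

theorem tendsto_sobolevNorm_ratio {α : ℝ} (hα : -1 < α) (l : ℕ) {r : ℕ} (hr : r ≤ 1)
    {g : ℕ → ℝ} {ρ : ℝ} (hρ : 0 < ρ) (hg : Tendsto (fun j : ℕ => g j / (j : ℝ)) atTop (𝓝 ρ)) :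
    ∃ C : ℝ, 0 < C ∧ Tendsto (fun j : ℕ => sobolevNorm α r (residual α l j) /
      sobolevNorm α l (tPoly α l j) / g j ^ (3 / 2 * (r : ℝ) - l)) atTop (𝓝 C) := by
  obtain ⟨cA, hcA, hA⟩ := exists_tendsto_jacSobSq hα hr
  refine exists_rates hα l r hcA (mul_pos (sum_symbWeight_pos l) (half_pos Real.pi_pos))
    (fun j => div_nonneg (sobolevNorm_nonneg _ _ _) (sobolevNorm_nonneg _ _ _)) (fun j hj => ?_) hA
    (tendsto_jacSobSq hα l) hρ hg
  rw [div_pow, sobolevNorm_sq_residual hα l j r hj, sobolevNorm_sq_tPoly hα]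

/-- If e < s, dividing the bound by g^s leaves K g^(e-s), which tends to 0 and contradicts the
positive limit C. -/
theorem le_of_tendsto_div_rpow {x g : ℕ → ℝ} {s e K C ρ : ℝ} (hC : 0 < C) (hρ : 0 < ρ)
    (hg : Tendsto (fun j : ℕ => g j / (j : ℝ)) atTop (𝓝 ρ))
    (hx : Tendsto (fun j => x j / g j ^ s) atTop (𝓝 C))
    (hle : ∀ᶠ j in atTop, x j ≤ K * g j ^ e) : s ≤ e := by
  by_contra! hlt
  have hgt : Tendsto g atTop atTop := by
    refine (hg.pos_mul_atTop hρ tendsto_natCast_atTop_atTop).congr' ?_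
    filter_upwards [eventually_gt_atTop 0] with j hj
    have : (j : ℝ) ≠ 0 := by positivity
    field_simp
  have h1 : Tendsto (fun j => K * g j ^ (-(s - e))) atTop (𝓝 (K * 0)) :=
    ((tendsto_rpow_neg_atTop (sub_pos.2 hlt)).comp hgt).const_mul K
  rw [mul_zero] at h1
  have h2 : C ≤ 0 := by
    refine le_of_tendsto_of_tendsto hx h1 ?_
    filter_upwards [hle, hgt.eventually_gt_atTop 0] with j hj hgj
    have h3 : 0 < g j ^ s := by positivity
    rw [div_le_iff₀ h3, mul_assoc, ← Real.rpow_add hgj, neg_sub, sub_add_cancel]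
    exact hj
  linarith

theorem l2Norm_residual {α : ℝ} (hα : -1 < α) (l j : ℕ) (hj : 1 ≤ j) :
    l2Norm α (residual α l j) = sobolevNorm α 0 (residual α l j) := by
  have hae := residual_ae_eq hα l j hj
  rw [sobolevNorm_congr α 0 hae, l2Norm, eLpNorm_congr_ae hae, ← l2Norm]
  set f : ℂ → ℂ := fun z =>
    ((tScale α l j * connCoeff α l (j + l) 0 : ℝ) : ℂ) * radial (jac (j + l) α 0) z
  have hf : ContDiff ℝ ∞ f := contDiff_const.mul (contDiff_radial _)
  refine (pow_left_inj₀ ENNReal.toReal_nonneg (sobolevNorm_nonneg _ _ _) two_ne_zero).1 ?_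
  change l2Norm α f ^ 2 = _
  rw [l2Norm_sq hα hf.continuous, sobolevNorm_sq hα 0 hf]
  simp [seminorm_sq hα 0 hf, partialDeriv]

end Zernike

end

theorem theorem3p13 (α : ℝ) (hα : -1 < α) :
    -- the power `-k` of `N + 1` in the weighted `L²` estimate cannot be lowered
    (∀ (k : ℕ) (e : ℝ),
      (∃ C : ℝ, ∀ u : ℂ → ℂ, Zernike.MemSobolev α k u → ∀ N : ℕ,
        Zernike.l2Norm α (u - Zernike.proj α N u)
          ≤ C * ((N : ℝ) + 1) ^ e * Zernike.sobolevNorm α k u) →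
      -(k : ℝ) ≤ e) ∧
    -- the power `3/2 - l` of `N` in the weighted `H¹` estimate cannot be lowered
    (∀ (l : ℕ), 1 ≤ l → ∀ e : ℝ,
      (∃ C : ℝ, ∀ u : ℂ → ℂ, Zernike.MemSobolev α l u → ∀ N : ℕ, 1 ≤ N →
        Zernike.sobolevNorm α 1 (u - Zernike.proj α N u)
          ≤ C * (N : ℝ) ^ e * Zernike.sobolevNorm α l u) →
      3 / 2 - (l : ℝ) ≤ e) ∧
    -- the explicit polynomials attain the rates, in the seminorms and in the norms
    (∀ (l r : ℕ), 1 ≤ l → r ≤ 1 →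
      (∃ C C' : ℝ, 0 < C ∧ 0 < C' ∧
        (fun j : ℕ => Zernike.seminorm α r (Zernike.residual α l j) /
            Zernike.seminorm α l (Zernike.tPoly α l j))
          ~[atTop] (fun j : ℕ => C * (j : ℝ) ^ (3 / 2 * (r : ℝ) - l)) ∧
        (fun j : ℕ => Zernike.seminorm α r (Zernike.residual α l j) /
            Zernike.seminorm α l (Zernike.tPoly α l j))
          ~[atTop] (fun j : ℕ => C' * (Zernike.truncDeg l j : ℝ) ^ (3 / 2 * (r : ℝ) - l))) ∧
      (∃ C C' : ℝ, 0 < C ∧ 0 < C' ∧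
        (fun j : ℕ => Zernike.sobolevNorm α r (Zernike.residual α l j) /
            Zernike.sobolevNorm α l (Zernike.tPoly α l j))
          ~[atTop] (fun j : ℕ => C * (j : ℝ) ^ (3 / 2 * (r : ℝ) - l)) ∧
        (fun j : ℕ => Zernike.sobolevNorm α r (Zernike.residual α l j) /
            Zernike.sobolevNorm α l (Zernike.tPoly α l j))
          ~[atTop] (fun j : ℕ => C' * (Zernike.truncDeg l j : ℝ) ^ (3 / 2 * (r : ℝ) - l)))) := by
  have hid : Tendsto (fun j : ℕ => (j : ℝ) / (j : ℝ)) atTop (nhds 1) := by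
    refine tendsto_const_nhds.congr' ?_
    filter_upwards [eventually_gt_atTop 0] with j hj
    rw [div_self (by positivity)]
  refine ⟨fun k e ⟨K, hK⟩ => ?_, fun l _ e ⟨K, hK⟩ => ?_, fun l r _ hr => ⟨?_, ?_⟩⟩
  · have hg := Zernike.tendsto_truncDeg_add_one_div k
    obtain ⟨C, hC, h⟩ := Zernike.tendsto_sobolevNorm_ratio hα k zero_le_one two_pos hg
    -- The sign of K is unknown, and |K| keeps the bound nonnegative; then `div_le_of_le_mul₀` needs
    -- no positivity of the norm of t_j in the denominator.
    have := Zernike.le_of_tendsto_div_rpow (K := |K|) (e := e) hC two_pos hg h ?_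
    · simpa using this
    filter_upwards [eventually_ge_atTop 1] with j hj
    have h1 := hK _ (Zernike.memSobolev_of_contDiff hα k (Zernike.contDiff_tPoly hα k j))
      (Zernike.truncDeg k j)
    rw [← Zernike.residual, Zernike.l2Norm_residual hα k j hj] at h1
    refine div_le_of_le_mul₀ (Zernike.sobolevNorm_nonneg _ _ _) (by positivity) (h1.trans ?_)
    gcongr
    · exact Zernike.sobolevNorm_nonneg _ _ _
    · exact le_abs_self K
  · have hg := Zernike.tendsto_truncDeg_div l
    obtain ⟨C, hC, h⟩ := Zernike.tendsto_sobolevNorm_ratio hα l le_rfl two_pos hg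
    have := Zernike.le_of_tendsto_div_rpow (K := |K|) (e := e) hC two_pos hg h ?_
    · simpa using this
    filter_upwards [eventually_ge_atTop 1] with j hj
    have h1 := hK _ (Zernike.memSobolev_of_contDiff hα l (Zernike.contDiff_tPoly hα l j))
      (Zernike.truncDeg l j) (by unfold Zernike.truncDeg; omega)
    rw [← Zernike.residual] at h1
    refine div_le_of_le_mul₀ (Zernike.sobolevNorm_nonneg _ _ _) (by positivity) (h1.trans ?_)
    gcongr
    · exact Zernike.sobolevNorm_nonneg _ _ _
    · exact le_abs_self K
  · obtain ⟨C, hC, h⟩ := Zernike.tendsto_seminorm_ratio hα l hr one_pos hid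
    obtain ⟨C', hC', h'⟩ := Zernike.tendsto_seminorm_ratio hα l hr two_pos
      (Zernike.tendsto_truncDeg_div l)
    exact ⟨C, C', hC, hC', Zernike.isEquivalent_of_tendsto_div hC h,
      Zernike.isEquivalent_of_tendsto_div hC' h'⟩
  · obtain ⟨C, hC, h⟩ := Zernike.tendsto_sobolevNorm_ratio hα l hr one_pos hid
    obtain ⟨C', hC', h'⟩ := Zernike.tendsto_sobolevNorm_ratio hα l hr two_pos
      (Zernike.tendsto_truncDeg_div l)
    exact ⟨C, C', hC, hC', Zernike.isEquivalent_of_tendsto_div hC h,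
      Zernike.isEquivalent_of_tendsto_div hC' h'⟩
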